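/- Let $d,N\ge 1$ be integers. For $k\ge 1$ let $\mathcal S_s(\mathbb R^{dk})$ be the space of complex-valued Schwartz functions $f(x_1,\dots,x_k)$, $x_i\in\mathbb R^d$, that are invariant under all permutations of $x_1,\dots,x_k$, with the subspace topology of $\mathcal S(\mathbb R^{dk})$, and let $\mathcal S_s'(\mathbb R^{dk})$ be its strong dual, in which $\mathcal S_s(\mathbb R^{dk})$ is included by $f\mapsto (g\mapsto\int fg)$. Let $\langle f,g\rangle=\int\overline f\,g$. Let $\mathfrak g_k$ be the real vector space of all continuous linear maps $A:\mathcal S_s(\mathbb R^{dk})\to\mathcal S_s(\mathbb R^{dk})$ that are skew-adjoint, i.e. $\langle Af,g\rangle=-\langle f,Ag\rangle$ for all $f,g\in \mathcal S_s(\mathbb R^{dk})$, with the subspace topology of $\mathcal L(\mathcal S_s(\mathbb R^{dk}),\mathcal S_s'(\mathbb R^{dk}))$, the latter with the topology of uniform convergence on bounded sets. Put $[A,B]_{\mathfrak g_k}=k(AB-BA)$. For $1\le k\le N$, $A\in\mathfrak g_k$ and a $k$-tuple $\underline j=(j_1,\dots,j_k)$ of distinct elements of $\{1,\dots,N\}$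 let $A_{\underline j}$ be the operator on $\mathcal S_s(\mathbb R^{dN})$ that acts as $A$ in the variables $(x_{j_1},\dots,x_{j_k})$ and as the identity in the other variables (for $\underline j=(1,\dots,k)$ it is $A\otimes \mathrm{Id}$), that is, $$(A_{\underline j}f)(x)=\bigl(A f_{\underline j,x}\bigr)(x_{j_1},\dots,x_{j_k}),$$ where $f_{\underline j,x}(y_1,\dots,y_k)$ is the value of $f$ at the point obtained from $x$ by replacing $x_{j_i}$ by $y_i$ for $i=1,\dots,k$. Put $$\epsilon_{k,N}(A)=\frac1{k!\binom Nk}\sum_{\underline j}A_{\underline j},$$ the sum being over all such tuples. Let $\mathfrak G_N=\bigoplus_{k=1}^N\mathfrak g_k$ be the locally convex direct sum. Then the following hold. 1. For $1\le k\le N$, $\epsilon_{k,N}$ is a well-defined injective continuous linear map $\mathfrak g_k\to\mathfrak g_N$. 2. For $1\le \ell,j\le N$, $$[\epsilon_{\ell,N}(\mathfrak g_\ell),\epsilon_{j,N}(\mathfrak g_j)]_{\mathfrak g_N}\subset\epsilon_{m,N}(\mathfrak g_m),\qquad m=\min\{\ell+j-1,N\}.$$ 3. Consequently the bracket $$[A,B]_{\mathfrak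 G_N}^{(k)}=\sum_{\substack{1\le\ell,j\le N\\ \min\{\ell+j-1,N\}=k}}\epsilon_{k,N}^{-1}\bigl([\epsilon_{\ell,N}(A^{(\ell)}),\epsilon_{j,N}(B^{(j)})]_{\mathfrak g_N}\bigr),\qquad 1\le k\le N,$$ is well defined for $A=(A^{(k)})_{k\le N}$ and $B=(B^{(k)})_{k\le N}$ in $\mathfrak G_N$, and $(\mathfrak G_N,[\cdot,\cdot]_{\mathfrak G_N})$ is a Lie algebra in the following sense: $\mathfrak G_N$ is a Hausdorff locally convex real vector space, and the bracket $\mathfrak G_N\times\mathfrak G_N\to\mathfrak G_N$ is separately continuous, bilinear, satisfies $[A,A]_{\mathfrak G_N}=0$ for all $A$, and satisfies the Jacobi identity. -/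

import Mathlib

open scoped SchwartzMap

noncomputable section

namespace Hierarchy

/-- The configuration space `(ℝ^d)^k` of `k` particles in `ℝ^d`.  Its norm is equivalent to the
Euclidean norm of `ℝ^{dk}` and its volume is the Lebesgue measure of `ℝ^{dk}`. -/
abbrev Config (d k : ℕ) : Type := Fin k → EuclideanSpace ℝ (Fin d)

instance (d k : ℕ) :
    (MeasureTheory.volume : MeasureTheory.Measure (Config d k)).IsAddHaarMeasure :=
  inferInstanceAs (MeasureTheory.Measure.pi fun _ : Fin k =>
    (MeasureTheory.volume : MeasureTheory.Measure (EuclideanSpace ℝ (Fin d)))).IsAddHaarMeasure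

/-- The bosonic (symmetric) Schwartz functions of `k` particles, a subspace of the Schwartz space
of `(ℝ^d)^k` and carrying its topology. -/
def bosonic (d k : ℕ) : Submodule ℂ 𝓢(Config d k, ℂ) where
  carrier := {f | ∀ (σ : Equiv.Perm (Fin k)) (x : Config d k), f (x ∘ σ) = f x}
  zero_mem' := fun _ _ => by simp
  add_mem' := fun {f g} hf hg σ x => by
    rw [add_apply, add_apply, hf σ x, hg σ x]
  smul_mem' := fun c f hf σ x => by
    rw [smul_apply, smul_apply, hf σ x]

/-- The bosonic Schwartz space `𝓢_s((ℝ^d)^k)`. -/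
abbrev Bosonic (d k : ℕ) : Type := ↥(bosonic d k)

/-- The space `𝓢_s'((ℝ^d)^k)` of bosonic tempered distributions, that is, the dual of the bosonic
Schwartz space with the strong dual topology (uniform convergence on bounded sets, which is the
topology that Mathlib puts on a space of continuous linear maps). -/
abbrev BosonicDual (d k : ℕ) : Type := Bosonic d k →L[ℂ] ℂ

/-- The `L²` inner product `⟨f, g⟩ = ∫ conj f · g`, linear in the second entry. -/
def l2Inner {d k : ℕ} (f g : Bosonic d k) : ℂ :=
  ∫ x, (starRingEnd ℂ) (f.1 x) * g.1 x

/-- A bosonic Schwartz function as an element of `L²`. -/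
def toL2 (d k : ℕ) : Bosonic d k →L[ℂ]
    MeasureTheory.Lp ℂ 2 (MeasureTheory.volume : MeasureTheory.Measure (Config d k)) :=
  (SchwartzMap.toLpCLM ℂ ℂ 2 MeasureTheory.volume).comp (bosonic d k).subtypeL

theorem coeFn_toL2 {d k : ℕ} (f : Bosonic d k) :
    toL2 d k f =ᵐ[MeasureTheory.volume] f.1 :=
  f.1.coeFn_toLp 2 MeasureTheory.volume

/-- The inclusion of the bosonic Schwartz space into its dual, `f ↦ (g ↦ ∫ f · g)`. -/
def toDual (d k : ℕ) : Bosonic d k →L[ℂ] BosonicDual d k :=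
  (ContinuousLinearMap.precomp ℂ (toL2 d k)).comp
    (((ContinuousLinearMap.mul ℂ ℂ).lpPairing MeasureTheory.volume 2 2).comp (toL2 d k))

theorem toDual_apply {d k : ℕ} (f g : Bosonic d k) :
    toDual d k f g = ∫ x, f.1 x * g.1 x := by
  have h : toDual d k f g = (ContinuousLinearMap.mul ℂ ℂ).lpPairing MeasureTheory.volume 2 2
    (toL2 d k f) (toL2 d k g) := rfl
  rw [h, ContinuousLinearMap.lpPairing_eq_integral]
  apply MeasureTheory.integral_congr_ae
  filter_upwards [coeFn_toL2 f, coeFn_toL2 g] with x hf hg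
  rw [hf, hg, ContinuousLinearMap.mul_apply']

theorem l2Inner_eq {d k : ℕ} (f g : Bosonic d k) :
    l2Inner f g = inner ℂ (toL2 d k f) (toL2 d k g) := by
  rw [MeasureTheory.L2.inner_def, l2Inner]
  apply MeasureTheory.integral_congr_ae
  filter_upwards [coeFn_toL2 f, coeFn_toL2 g] with x hf hg
  rw [hf, hg, RCLike.inner_apply, mul_comm]

theorem l2Inner_add_left {d k : ℕ} (f f' g : Bosonic d k) :
    l2Inner (f + f') g = l2Inner f g + l2Inner f' g := by
  simp only [l2Inner_eq, map_add, inner_add_left]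

theorem l2Inner_add_right {d k : ℕ} (f g g' : Bosonic d k) :
    l2Inner f (g + g') = l2Inner f g + l2Inner f g' := by
  simp only [l2Inner_eq, map_add, inner_add_right]

theorem l2Inner_smul_left {d k : ℕ} (c : ℂ) (f g : Bosonic d k) :
    l2Inner (c • f) g = (starRingEnd ℂ) c * l2Inner f g := by
  simp only [l2Inner_eq, map_smul, inner_smul_left]

theorem l2Inner_smul_right {d k : ℕ} (c : ℂ) (f g : Bosonic d k) :
    l2Inner f (c • g) = c * l2Inner f g := by
  simp only [l2Inner_eq, map_smul, inner_smul_right]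

theorem l2Inner_real_smul_left {d k : ℕ} (c : ℝ) (f g : Bosonic d k) :
    l2Inner (c • f) g = c * l2Inner f g := by
  rw [← Complex.coe_smul, l2Inner_smul_left, Complex.conj_ofReal]

theorem l2Inner_real_smul_right {d k : ℕ} (c : ℝ) (f g : Bosonic d k) :
    l2Inner f (c • g) = c * l2Inner f g := by
  rw [← Complex.coe_smul, l2Inner_smul_right]

/-- The real vector space of skew-adjoint operators: those continuous linear maps `A` of the
bosonic Schwartz space into itself with `A* = -A`, that is, `⟨A f, g⟩ = -⟨f, A g⟩` for all test
functions. -/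
def skewAdjoints (d k : ℕ) : Submodule ℝ (Bosonic d k →L[ℂ] Bosonic d k) where
  carrier := {A | ∀ f g : Bosonic d k, l2Inner (A f) g = -l2Inner f (A g)}
  zero_mem' := fun f g => by
    simp [l2Inner]
  add_mem' := fun {A B} hA hB f g => by
    rw [add_apply, add_apply, l2Inner_add_left,
      l2Inner_add_right, hA f g, hB f g]
    ring
  smul_mem' := fun c A hA f g => by
    change l2Inner (c • A f) g = -l2Inner f (c • A g)
    rw [l2Inner_real_smul_left, l2Inner_real_smul_right, hA f g]
    ring

/-- The space `𝔤_k` of `k`-particle bosonic observables.  It is a type of its own since its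
topology is not the topology of bounded convergence of maps into the bosonic Schwartz space. -/
def Observable (d k : ℕ) : Type := ↥(skewAdjoints d k)

namespace Observable

instance (d k : ℕ) : AddCommGroup (Observable d k) :=
  inferInstanceAs (AddCommGroup ↥(skewAdjoints d k))

instance (d k : ℕ) : Module ℝ (Observable d k) :=
  inferInstanceAs (Module ℝ ↥(skewAdjoints d k))

/-- The operator on the bosonic Schwartz space underlying an observable. -/
def op {d k : ℕ} (A : Observable d k) : Bosonic d k →L[ℂ] Bosonic d k := A.val

theorem skew {d k : ℕ} (A : Observable d k) (f g : Bosonic d k) :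
    l2Inner (A.op f) g = -l2Inner f (A.op g) := A.property f g

/-- `𝔤_k` has the subspace topology of `L(𝓢_s, 𝓢_s')`, the latter with the topology of bounded
convergence. -/
instance (d k : ℕ) : TopologicalSpace (Observable d k) :=
  TopologicalSpace.induced
    (fun A => ((toDual d k).comp A.op : Bosonic d k →L[ℂ] BosonicDual d k)) inferInstance

/-- The Lie bracket `[A, B]_{𝔤_k} = k (A B - B A)`. -/
def lie {d k : ℕ} (A B : Observable d k) : Observable d k :=
  ⟨(k : ℝ) • (A.op.comp B.op - B.op.comp A.op), (skewAdjoints d k).smul_mem _ (fun f g => by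
    have h (u : Bosonic d k) : (A.op.comp B.op - B.op.comp A.op) u =
        A.op (B.op u) + (-1 : ℝ) • B.op (A.op u) := by
      rw [neg_one_smul, ← sub_eq_add_neg]
      rfl
    rw [h, h]
    simp only [l2Inner_add_left, l2Inner_add_right, l2Inner_real_smul_left,
      l2Inner_real_smul_right, skew, Complex.ofReal_neg, Complex.ofReal_one]
    ring)⟩

end Observable

/-- The map `y ↦ x` with the coordinates `j_1, …, j_k` of `x` replaced by `y_1, …, y_k`. -/
def insert {d k N : ℕ} (j : Fin k ↪ Fin N) (x : Config d N) (y : Config d k) : Config d N :=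
  Function.extend j y x

theorem insert_hasTemperateGrowth {d k N : ℕ} (j : Fin k ↪ Fin N) (x : Config d N) :
    (insert j x : Config d k → Config d N).HasTemperateGrowth := by
  classical
  let L : Config d k →L[ℝ] Config d N := ContinuousLinearMap.pi fun a =>
    if h : ∃ i, j i = a then ContinuousLinearMap.proj h.choose else 0
  have h : (insert j x : Config d k → Config d N) = fun y => L y + insert j x 0 := by
    funext y a
    simp only [insert, Function.extend, L, Pi.add_apply, ContinuousLinearMap.pi_apply]
    split_ifs <;> simp
  rw [h]
  exact L.hasTemperateGrowth.add (Function.HasTemperateGrowth.const _)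

theorem insert_antilipschitz {d k N : ℕ} (j : Fin k ↪ Fin N) (x : Config d N) :
    AntilipschitzWith 1 (insert j x : Config d k → Config d N) := by
  refine AntilipschitzWith.of_le_mul_dist fun y z => ?_
  rw [NNReal.coe_one, one_mul, dist_pi_le_iff dist_nonneg]
  intro i
  have h := dist_le_pi_dist (insert j x y) (insert j x z) (j i)
  simpa only [insert, j.injective.extend_apply] using h

theorem insert_comp_perm {d k N : ℕ} (j : Fin k ↪ Fin N) (x : Config d N) (y : Config d k)
    (σ : Equiv.Perm (Fin k)) :
    insert j x (y ∘ σ) = insert j x y ∘ σ.viaFintypeEmbedding j := by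
  funext a
  by_cases ha : ∃ i, j i = a
  · obtain ⟨i, rfl⟩ := ha
    simp only [insert, Function.comp_apply, Equiv.Perm.viaFintypeEmbedding_apply_image,
      j.injective.extend_apply]
  · have h : a ∉ Set.range j := ha
    rw [Function.comp_apply, Equiv.Perm.viaFintypeEmbedding_apply_notMem_range _ _ h]
    simp only [insert, Function.extend_apply' _ _ _ ha]

/-- A bosonic function of `N` particles as a function of the particles `j_1, …, j_k` only, the
other particles being frozen at their positions in `x`. -/
def slice {d k N : ℕ} (j : Fin k ↪ Fin N) (x : Config d N) (f : Bosonic d N) : Bosonic d k :=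
  ⟨SchwartzMap.compCLMOfAntilipschitz ℂ (insert_hasTemperateGrowth j x)
    (insert_antilipschitz j x) f.1, fun σ y => by
      change f.1 (insert j x (y ∘ σ)) = f.1 (insert j x y)
      rw [insert_comp_perm]
      exact f.2 _ _⟩

theorem slice_apply {d k N : ℕ} (j : Fin k ↪ Fin N) (x : Config d N) (f : Bosonic d N)
    (y : Config d k) : (slice j x f).1 y = f.1 (insert j x y) := rfl

/-- The `k`-particle extension `A_{(j_1, …, j_k)}` of `A`, acting on bosonic functions of `N`
particles: the operator `A` acts in the variables `x_{j_1}, …, x_{j_k}` and the identity acts in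
the others.  For `(j_1, …, j_k) = (1, …, k)` this is `A ⊗ Id`: if `f` is a linear combination of
tensors `u(x_1, …, x_k) v(x_{k+1}, …, x_N)`, its image is that of `(A u) ⊗ v`. -/
def extension {d k N : ℕ} (A : Observable d k) (j : Fin k ↪ Fin N) (f : Bosonic d N) :
    Config d N → ℂ :=
  fun x => (A.op (slice j x f)).1 (x ∘ j)

/-- `E = C_{k,N} ∑ A_{(j_1, …, j_k)}`, where the sum is over all `k`-tuples of distinct elements
of `{1, …, N}` and `C_{k,N} = 1 / (k! (N choose k))` is the inverse of their number. -/
def IsEmbedded {d k N : ℕ} (A : Observable d k) (E : Observable d N) : Prop :=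
  ∀ (f : Bosonic d N) (x : Config d N), (E.op f).1 x =
    ((k.factorial * N.choose k : ℕ) : ℂ)⁻¹ * ∑ j : Fin k ↪ Fin N, extension A j f x

open Classical in
/-- The embedding `ε_{k,N} : 𝔤_k → 𝔤_N`: the value at `A` is the only `E` in `𝔤_N` with
`IsEmbedded A E` (and it would be `0` if there were none). -/
def embed {d k : ℕ} (N : ℕ) (A : Observable d k) : Observable d N :=
  if h : ∃ E : Observable d N, IsEmbedded A E then h.choose else 0

/-- The space `𝔊_N = 𝔤_1 ⊕ … ⊕ 𝔤_N` of observable `N`-hierarchies.  The sum is finite, so the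
locally convex direct sum is the product with the product topology. -/
abbrev Hier (d N : ℕ) : Type := (k : ↥(Finset.Icc 1 N)) → Observable d k.1

/-- The bracket of `𝔊_N`: its component `k` is the sum over all `1 ≤ ℓ, j ≤ N` with
`min (ℓ + j - 1) N = k` of `ε_{k,N}⁻¹ [ε_{ℓ,N} A_ℓ, ε_{j,N} B_j]_{𝔤_N}`, where `ε_{k,N}⁻¹` is
the inverse of `ε_{k,N}` on its image. -/
def bracket {d N : ℕ} (A B : Hier d N) : Hier d N := fun k =>
  ∑ p : ↥(Finset.Icc 1 N) × ↥(Finset.Icc 1 N) with min (p.1.1 + p.2.1 - 1) N = k.1,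
    Function.invFun (embed N : Observable d k.1 → Observable d N)
      (Observable.lie (embed N (A p.1)) (embed N (B p.2)))

/-- A (real) Lie algebra: a Hausdorff locally convex space with a separately continuous binary
operation that is bilinear, alternating, and satisfies the Jacobi identity. -/
structure IsLieAlgebra (E : Type) [AddCommGroup E] [Module ℝ E] [TopologicalSpace E]
    (br : E → E → E) : Prop where
  isTopologicalAddGroup : IsTopologicalAddGroup E
  continuousSMul : ContinuousSMul ℝ E
  locallyConvex : LocallyConvexSpace ℝ E
  hausdorff : T2Space E
  continuous_left : ∀ y, Continuous fun x => br x y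
  continuous_right : ∀ x, Continuous fun y => br x y
  add_left : ∀ x x' y, br (x + x') y = br x y + br x' y
  add_right : ∀ x y y', br x (y + y') = br x y + br x y'
  smul_left : ∀ (c : ℝ) (x y), br (c • x) y = c • br x y
  smul_right : ∀ (c : ℝ) (x y), br x (c • y) = c • br x y
  self : ∀ x, br x x = 0
  jacobi : ∀ x y z, br x (br y z) + br z (br x y) + br y (br z x) = 0

end Hierarchy

end

open scoped SchwartzMap

noncomputable section

namespace Hierarchy

open LineDeriv

/-! ### Line derivatives, Taylor estimates and seminorm bounds for Schwartz functions -/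

section Schwartz

variable {E F : Type*} [NormedAddCommGroup E] [NormedSpace ℝ E]
  [NormedAddCommGroup F] [NormedSpace ℝ F]

/-! An observable `A` is replaced by `A.ext`, its composition with symmetrization. This is a
skew-adjoint operator on all Schwartz functions, so the single terms `lift j A.ext`, which need not
preserve symmetry, can be composed freely. A lift acts on every slice with frozen outer variables as
the original operator (`sliceMap_lift`). Fubini over the slices therefore carries skew-adjointness
to lifts (`IsSkew.lift`). That a lift maps Schwartz functions to Schwartz functions rests on its
derivative being a finite combination of lifts again (`fderiv_liftFun`).

Injectivity is tested on pure powers of a one-particle function p. If the embedded `A` vanishes, the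
symmetrized product of a power of p with h = A(p⊗...⊗p) is zero. Evaluating where most coordinates
sit at a point b with p(b) ≠ 0 gives h = 0 by induction on the number of other coordinates
(`eq_zero_of_sum_mul_prod_eq_zero`). By skew-adjointness the range of `A` is orthogonal to all pure
powers, hence zero by polarization.

For the bracket, the commutator of two sums of lifts is a double sum over pairs of tuples. Disjoint
pairs contribute nothing, since operators in disjoint variables commute (`lift_comp_comm`). An
overlapping pair involves at most min(l + j - 1, N) ≤ m particles, so it factors through an m-tuple.
Weighting each commutator on m particles by the inverse number of its factorizations gives an
explicit preimage `commObs` (`lie_embed_embed`).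

Continuity is read off from the seminorms sup |⟨v, A u⟩| over bounded sets of u and v. The slices of
a bounded set remain bounded after multiplication by a power of the frozen variables, which makes
the Fubini integral converge uniformly (`isControlled_lift`). In a commutator with a fixed `B`,
skewness moves `B` onto one of the test functions, so only the boundedness of the fixed lifts of `B`
is used. This gives separate continuity.

The Lie identities follow from those in 𝔤_N, because each embedding is injective and the truncated
degree of an iterated bracket depends only on the sum of the three degrees. -/

theorem lineDeriv_comm (v w : E) (f : 𝓢(E, F)) : ∂_{v} (∂_{w} f) = ∂_{w} (∂_{v} f) := by
  have h2 (a b : E) (x : E) : ∂_{a} (∂_{b} f) x = fderiv ℝ (fderiv ℝ f) x a b := by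
    rw [SchwartzMap.lineDerivOp_apply_eq_fderiv]
    have h3 : (∂_{b} f : 𝓢(E, F)) = fun y => fderiv ℝ f y b := by
      funext y
      rw [SchwartzMap.lineDerivOp_apply_eq_fderiv]
    rw [h3, fderiv_clm_apply]
    · simp
    · exact ((f.smooth 2).fderiv_right (m := 1) (by norm_num)).differentiable (by norm_num) x
    · fun_prop
  ext x
  rw [h2, h2]
  have := (f.contDiffAt 2 (x := x)).isSymmSndFDerivAt (by simp)
  exact this v w

theorem lineDeriv_iterated_comm {n : ℕ} (m : Fin n → E) (w : E) (f : 𝓢(E, F)) :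
    ∂_{w} (∂^{m} f) = ∂^{m} (∂_{w} f) := by
  induction n with
  | zero => simp
  | succ n ih =>
    rw [iteratedLineDerivOp_succ_left, iteratedLineDerivOp_succ_left, lineDeriv_comm, ih]

/-- Line derivatives commute, so the outermost direction w can be moved innermost. The Taylor
estimates below can then be stated with the Schwartz function `∂_{w} f` at every order n. -/
theorem fderiv_iteratedFDeriv_apply (n : ℕ) (f : 𝓢(E, F)) (x w : E) :
    fderiv ℝ (iteratedFDeriv ℝ n f) x w = iteratedFDeriv ℝ n (∂_{w} f : 𝓢(E, F)) x := by
  ext m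
  rw [← SchwartzMap.iteratedLineDerivOp_eq_iteratedFDeriv, ← lineDeriv_iterated_comm]
  have h : ∂^{(Fin.cons w m : Fin (n + 1) → E)} f x =
      iteratedFDeriv ℝ (n + 1) f x (Fin.cons w m) :=
    SchwartzMap.iteratedLineDerivOp_eq_iteratedFDeriv
  rw [iteratedLineDerivOp_succ_left, iteratedFDeriv_succ_apply_left] at h
  simpa using h.symm

theorem norm_iteratedFDeriv_lineDeriv_le (n : ℕ) (f : 𝓢(E, F)) (x w : E) :
    ‖iteratedFDeriv ℝ n (∂_{w} f : 𝓢(E, F)) x‖ ≤ ‖iteratedFDeriv ℝ (n + 1) f x‖ * ‖w‖ := by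
  rw [← fderiv_iteratedFDeriv_apply, ← norm_fderiv_iteratedFDeriv]
  exact ContinuousLinearMap.le_opNorm _ _

theorem hasFDerivAt_iteratedFDeriv (n : ℕ) (f : 𝓢(E, F)) (x : E) :
    HasFDerivAt (iteratedFDeriv ℝ n f) (fderiv ℝ (iteratedFDeriv ℝ n f) x) x :=
  ((f.smooth ⊤).differentiable_iteratedFDeriv (mod_cast ENat.natCast_lt_top n) x).hasFDerivAt

theorem norm_iteratedFDeriv_add_sub_le {n : ℕ} {f : 𝓢(E, F)} {x w : E} {M : ℝ}
    (h : ∀ t ∈ Set.Icc (0 : ℝ) 1, ‖iteratedFDeriv ℝ (n + 1) f (x + t • w)‖ ≤ M) {t : ℝ}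
    (ht : t ∈ Set.Icc (0 : ℝ) 1) :
    ‖iteratedFDeriv ℝ n f (x + t • w) - iteratedFDeriv ℝ n f x‖ ≤ M * ‖w‖ := by
  have hd (s : ℝ) : HasDerivAt (fun s : ℝ => iteratedFDeriv ℝ n f (x + s • w))
      (fderiv ℝ (iteratedFDeriv ℝ n f) (x + s • w) w) s := by
    have h1 : HasDerivAt (fun s : ℝ => x + s • w) w s := by
      simpa using ((hasDerivAt_id s).smul_const w).const_add x
    exact (hasFDerivAt_iteratedFDeriv n f (x + s • w)).comp_hasDerivAt s h1
  have hM : 0 ≤ M := (norm_nonneg _).trans (h 0 (by simp))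
  have key := norm_image_sub_le_of_norm_deriv_le_segment' (a := 0) (b := 1)
    (f := fun s : ℝ => iteratedFDeriv ℝ n f (x + s • w))
    (C := M * ‖w‖) (fun s _ => (hd s).hasDerivWithinAt) (fun s hs => by
      refine (ContinuousLinearMap.le_opNorm _ _).trans ?_
      rw [norm_fderiv_iteratedFDeriv]
      gcongr
      exact h s ⟨hs.1, hs.2.le⟩) t ht
  simp only [zero_smul, add_zero, sub_zero] at key
  refine key.trans ?_
  exact mul_le_of_le_one_right (by positivity) ht.2

/-- The mean value inequality applies to s ↦ Dⁿf(x + s w) - s Dⁿ(∂_w f)(x): its derivative is an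
increment of Dⁿ(∂_w f), bounded by the preceding lemma. The sharp factor 1/2 is not needed. -/
theorem norm_iteratedFDeriv_taylor_le {n : ℕ} {f : 𝓢(E, F)} {x w : E} {M : ℝ}
    (h : ∀ t ∈ Set.Icc (0 : ℝ) 1, ‖iteratedFDeriv ℝ (n + 2) f (x + t • w)‖ ≤ M) :
    ‖iteratedFDeriv ℝ n f (x + w) - iteratedFDeriv ℝ n f x -
      iteratedFDeriv ℝ n (∂_{w} f : 𝓢(E, F)) x‖ ≤ M * ‖w‖ ^ 2 := by
  have hd (s : ℝ) : HasDerivAt (fun s : ℝ => iteratedFDeriv ℝ n f (x + s • w) -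
      s • iteratedFDeriv ℝ n (∂_{w} f : 𝓢(E, F)) x)
      (iteratedFDeriv ℝ n (∂_{w} f : 𝓢(E, F)) (x + s • w) -
        iteratedFDeriv ℝ n (∂_{w} f : 𝓢(E, F)) x) s := by
    have h1 : HasDerivAt (fun s : ℝ => x + s • w) w s := by
      simpa using ((hasDerivAt_id s).smul_const w).const_add x
    rw [← fderiv_iteratedFDeriv_apply n f (x + s • w)]
    refine ((hasFDerivAt_iteratedFDeriv n f (x + s • w)).comp_hasDerivAt s h1).sub ?_
    simpa using (hasDerivAt_id s).smul_const (iteratedFDeriv ℝ n (∂_{w} f : 𝓢(E, F)) x)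
  have key := norm_image_sub_le_of_norm_deriv_le_segment_01'
    (f := fun s : ℝ => iteratedFDeriv ℝ n f (x + s • w) -
      s • iteratedFDeriv ℝ n (∂_{w} f : 𝓢(E, F)) x)
    (C := M * ‖w‖ * ‖w‖) (fun s _ => (hd s).hasDerivWithinAt) (fun s hs => by
      refine norm_iteratedFDeriv_add_sub_le (fun t ht => ?_) ⟨hs.1, hs.2.le⟩
      refine (norm_iteratedFDeriv_lineDeriv_le _ _ _ _).trans ?_
      gcongr
      exact h t ht)
  simp only [one_smul, zero_smul, add_zero, sub_zero] at key
  rw [sub_right_comm] at key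
  rw [sq, ← mul_assoc]
  exact key

theorem seminorm_lineDeriv_le (a b : ℕ) (f : 𝓢(E, F)) (w : E) :
    SchwartzMap.seminorm ℝ a b (∂_{w} f : 𝓢(E, F)) ≤
      SchwartzMap.seminorm ℝ a (b + 1) f * ‖w‖ := by
  refine SchwartzMap.seminorm_le_bound ℝ a b _ (by positivity) fun x => ?_
  calc ‖x‖ ^ a * ‖iteratedFDeriv ℝ b (∂_{w} f : 𝓢(E, F)) x‖
      ≤ ‖x‖ ^ a * (‖iteratedFDeriv ℝ (b + 1) f x‖ * ‖w‖) := by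
        gcongr; exact norm_iteratedFDeriv_lineDeriv_le _ _ _ _
    _ = (‖x‖ ^ a * ‖iteratedFDeriv ℝ (b + 1) f x‖) * ‖w‖ := by ring
    _ ≤ _ := by gcongr; exact SchwartzMap.le_seminorm ℝ a (b + 1) f x

variable {E' F' : Type*} [NormedAddCommGroup E'] [NormedSpace ℝ E']
  [NormedAddCommGroup F'] [NormedSpace ℝ F'] [NormedSpace ℂ F] [NormedSpace ℂ F']

/-- A sum of seminorms, instead of the usual supremum, allows later estimates to be inserted term by
term. -/
theorem exists_seminorm_map_le (T : 𝓢(E, F) →L[ℂ] 𝓢(E', F')) (a b : ℕ) :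
    ∃ (s : Finset (ℕ × ℕ)) (C : ℝ), 0 ≤ C ∧ ∀ f, SchwartzMap.seminorm ℝ a b (T f) ≤
      C * ∑ n ∈ s, SchwartzMap.seminorm ℝ n.1 n.2 f := by
  have hc : Continuous ((SchwartzMap.seminorm ℝ a b).comp
      (T.restrictScalars ℝ).toLinearMap) :=
    ((schwartz_withSeminorms ℝ E' F').continuous_seminorm (a, b)).comp T.continuous
  obtain ⟨s, C, -, h⟩ := Seminorm.bound_of_continuous (schwartz_withSeminorms ℝ E F) _ hc
  refine ⟨s, C, C.2, fun f => (h f).trans ?_⟩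
  change C * (s.sup (schwartzSeminormFamily ℝ E F)) f ≤ _
  refine mul_le_mul_of_nonneg_left ?_ C.2
  refine (Seminorm.finset_sup_le_sum _ s f).trans_eq ?_
  rw [sum_apply]
  rfl

end Schwartz

/-! ### Slices, and the operator acting in some of the variables -/

section Lift

open LineDeriv

/-- The Schwartz functions of `k` particles, without any symmetry. -/
abbrev Test (d k : ℕ) : Type := 𝓢(Config d k, ℂ)

variable {d k N : ℕ}

/-- The linear part of `insert j x`: extension by zero. -/
def insertL (j : Fin k ↪ Fin N) : Config d k →L[ℝ] Config d N :=
  LinearMap.toContinuousLinearMap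
    { toFun := fun y => insert j 0 y
      map_add' := fun y z => by
        funext a
        by_cases ha : ∃ i, j i = a
        · obtain ⟨i, rfl⟩ := ha
          simp [insert, j.injective.extend_apply]
        · simp [insert, Function.extend_apply' _ _ _ ha]
      map_smul' := fun c y => by
        funext a
        by_cases ha : ∃ i, j i = a
        · obtain ⟨i, rfl⟩ := ha
          simp [insert, j.injective.extend_apply]
        · simp [insert, Function.extend_apply' _ _ _ ha] }

theorem insert_apply_self (j : Fin k ↪ Fin N) (x : Config d N) (y : Config d k) (i : Fin k) :
    insert j x y (j i) = y i := j.injective.extend_apply _ _ _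

theorem insert_apply_of_notMem (j : Fin k ↪ Fin N) (x : Config d N) (y : Config d k) {a : Fin N}
    (ha : a ∉ Set.range j) : insert j x y a = x a := Function.extend_apply' _ _ _ ha

theorem insert_comp (j : Fin k ↪ Fin N) (x : Config d N) (y : Config d k) :
    insert j x y ∘ j = y := funext fun i => insert_apply_self j x y i

theorem insert_insert (j : Fin k ↪ Fin N) (x : Config d N) (y z : Config d k) :
    insert j (insert j x y) z = insert j x z := by
  funext a
  by_cases ha : a ∈ Set.range j
  · obtain ⟨i, rfl⟩ := ha
    simp only [insert_apply_self]
  · simp only [insert_apply_of_notMem _ _ _ ha]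

theorem insert_self (j : Fin k ↪ Fin N) (x : Config d N) : insert j x (x ∘ j) = x := by
  funext a
  by_cases ha : a ∈ Set.range j
  · obtain ⟨i, rfl⟩ := ha
    simp only [insert_apply_self, Function.comp_apply]
  · simp only [insert_apply_of_notMem _ _ _ ha]

theorem insert_add (j : Fin k ↪ Fin N) (x v : Config d N) (y z : Config d k) :
    insert j (x + v) (y + z) = insert j x y + insert j v z := by
  funext a
  by_cases ha : a ∈ Set.range j
  · obtain ⟨i, rfl⟩ := ha
    simp only [insert_apply_self, Pi.add_apply]
  · simp only [insert_apply_of_notMem _ _ _ ha, Pi.add_apply]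

theorem insert_smul (j : Fin k ↪ Fin N) (c : ℝ) (x : Config d N) (y : Config d k) :
    insert j (c • x) (c • y) = c • insert j x y := by
  funext a
  by_cases ha : a ∈ Set.range j
  · obtain ⟨i, rfl⟩ := ha
    simp only [insert_apply_self, Pi.smul_apply]
  · simp only [insert_apply_of_notMem _ _ _ ha, Pi.smul_apply]

theorem insertL_apply (j : Fin k ↪ Fin N) (y : Config d k) : insertL j y = insert j 0 y := rfl

theorem insert_eq_insertL_add (j : Fin k ↪ Fin N) (x : Config d N) (y : Config d k) :
    insert j x y = insertL j y + insert j x 0 := by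
  rw [insertL_apply, ← insert_add, zero_add, add_zero]

theorem norm_insertL_le (j : Fin k ↪ Fin N) : ‖(insertL j : Config d k →L[ℝ] Config d N)‖ ≤ 1 := by
  refine ContinuousLinearMap.opNorm_le_bound _ zero_le_one fun y => ?_
  rw [one_mul, pi_norm_le_iff_of_nonneg (norm_nonneg _)]
  intro a
  rw [insertL_apply]
  by_cases ha : a ∈ Set.range j
  · obtain ⟨i, rfl⟩ := ha
    rw [insert_apply_self]
    exact norm_le_pi_norm y i
  · rw [insert_apply_of_notMem _ _ _ ha]
    simp

theorem norm_le_norm_insert (j : Fin k ↪ Fin N) (x : Config d N) (y : Config d k) :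
    ‖y‖ ≤ ‖insert j x y‖ := by
  rw [pi_norm_le_iff_of_nonneg (norm_nonneg _)]
  intro i
  rw [← insert_apply_self j x y i]
  exact norm_le_pi_norm _ _

theorem norm_insert_zero_le (j : Fin k ↪ Fin N) (x : Config d N) (y : Config d k) :
    ‖insert j x 0‖ ≤ ‖insert j x y‖ := by
  rw [pi_norm_le_iff_of_nonneg (norm_nonneg _)]
  intro a
  refine le_trans ?_ (norm_le_pi_norm (insert j x y) a)
  by_cases ha : a ∈ Set.range j
  · obtain ⟨i, rfl⟩ := ha
    simp [insert_apply_self]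
  · simp only [insert_apply_of_notMem _ _ _ ha, le_refl]

theorem norm_comp_le (j : Fin k ↪ Fin N) (x : Config d N) : ‖x ∘ j‖ ≤ ‖x‖ := by
  rw [pi_norm_le_iff_of_nonneg (norm_nonneg _)]
  exact fun i => norm_le_pi_norm x (j i)

theorem norm_insert_zero_le_norm (j : Fin k ↪ Fin N) (x : Config d N) :
    ‖insert j x 0‖ ≤ ‖x‖ := by
  simpa only [insert_self] using norm_insert_zero_le j x (x ∘ j)

/-- Decay in x splits into decay in the active variables `x ∘ j` and in the frozen ones `insert j x
0`. -/
theorem norm_le_max_insert (j : Fin k ↪ Fin N) (x : Config d N) :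
    ‖x‖ ≤ max ‖x ∘ j‖ ‖insert j x 0‖ := by
  rw [pi_norm_le_iff_of_nonneg (le_max_of_le_left (norm_nonneg _))]
  intro a
  by_cases ha : a ∈ Set.range j
  · obtain ⟨i, rfl⟩ := ha
    exact le_max_of_le_left (norm_le_pi_norm (x ∘ j) i)
  · refine le_max_of_le_right ?_
    rw [← insert_apply_of_notMem j x 0 ha]
    exact norm_le_pi_norm _ a

/-- Freezing the particles outside the range of `j` at their positions in `x`. -/
def sliceMap (j : Fin k ↪ Fin N) (x : Config d N) : Test d N →L[ℂ] Test d k :=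
  SchwartzMap.compCLMOfAntilipschitz ℂ (insert_hasTemperateGrowth j x) (insert_antilipschitz j x)

theorem sliceMap_apply (j : Fin k ↪ Fin N) (x : Config d N) (F : Test d N) (y : Config d k) :
    sliceMap j x F y = F (insert j x y) := rfl

theorem slice_val (j : Fin k ↪ Fin N) (x : Config d N) (f : Bosonic d N) :
    (slice j x f).1 = sliceMap j x f.1 := rfl

/-- A slice is a translate of F composed with the zero extension `insertL j`, whose norm is at most
1. -/
theorem norm_iteratedFDeriv_sliceMap_le (j : Fin k ↪ Fin N) (x : Config d N) (F : Test d N)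
    (b : ℕ) (y : Config d k) :
    ‖iteratedFDeriv ℝ b (sliceMap j x F) y‖ ≤ ‖iteratedFDeriv ℝ b F (insert j x y)‖ := by
  have h : (sliceMap j x F : Config d k → ℂ) =
      (fun z => F (z + insert j x 0)) ∘ (insertL j : Config d k →L[ℝ] Config d N) := by
    funext y
    rw [sliceMap_apply, insert_eq_insertL_add]
    rfl
  have hs : ContDiff ℝ b (fun z => F (z + insert j x 0)) :=
    (F.smooth b).comp (contDiff_id.add contDiff_const)
  rw [h, (insertL j).iteratedFDeriv_comp_right hs _ le_rfl,
    iteratedFDeriv_comp_add_right, ← insert_eq_insertL_add]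
  refine (ContinuousMultilinearMap.norm_compContinuousLinearMap_le _ _).trans ?_
  refine mul_le_of_le_one_right (norm_nonneg _) ?_
  exact Finset.prod_le_one (fun _ _ => norm_nonneg _) fun _ _ => norm_insertL_le j

/-- In the sup norm both y and the frozen part are dominated by `insert j x y`, so the weight c + a
on F pays for both. Slices thus decay rapidly in the frozen variables, in every seminorm. -/
theorem pow_mul_seminorm_sliceMap_le (j : Fin k ↪ Fin N) (x : Config d N) (F : Test d N)
    (c a b : ℕ) : ‖insert j x 0‖ ^ c * SchwartzMap.seminorm ℝ a b (sliceMap j x F) ≤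
      SchwartzMap.seminorm ℝ (c + a) b F := by
  rcases (pow_nonneg (norm_nonneg (insert j x (0 : Config d k))) c).eq_or_lt with h0 | h0
  · rw [← h0, zero_mul]
    exact apply_nonneg _ _
  rw [mul_comm, ← le_div_iff₀ h0]
  refine SchwartzMap.seminorm_le_bound ℝ a b _ (by positivity) fun y => ?_
  rw [le_div_iff₀ h0]
  calc ‖y‖ ^ a * ‖iteratedFDeriv ℝ b (sliceMap j x F) y‖ * ‖insert j x (0 : Config d k)‖ ^ c
      ≤ ‖insert j x y‖ ^ a * ‖iteratedFDeriv ℝ b F (insert j x y)‖ * ‖insert j x y‖ ^ c := by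
        gcongr
        · exact norm_le_norm_insert j x y
        · exact norm_iteratedFDeriv_sliceMap_le j x F b y
        · exact norm_insert_zero_le j x y
    _ = ‖insert j x y‖ ^ (c + a) * ‖iteratedFDeriv ℝ b F (insert j x y)‖ := by ring
    _ ≤ _ := SchwartzMap.le_seminorm ℝ (c + a) b F _

theorem seminorm_sliceMap_le (j : Fin k ↪ Fin N) (x : Config d N) (F : Test d N) (a b : ℕ) :
    SchwartzMap.seminorm ℝ a b (sliceMap j x F) ≤ SchwartzMap.seminorm ℝ a b F := by
  simpa using pow_mul_seminorm_sliceMap_le j x F 0 a b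

/-- The slice depends differentiably on the frozen variables in the Schwartz topology: its
first-order remainder is the slice of the Taylor remainder of F in the direction w. -/
theorem seminorm_sliceMap_taylor_le (j : Fin k ↪ Fin N) (x v : Config d N) (F : Test d N)
    (a b : ℕ) : SchwartzMap.seminorm ℝ a b (sliceMap j (x + v) F - sliceMap j x F -
      sliceMap j x (∂_{insert j v 0} F)) ≤ SchwartzMap.seminorm ℝ a (b + 2) F * ‖v‖ ^ 2 := by
  set w : Config d N := insert j v 0 with hw
  let R : Test d N := SchwartzMap.compSubConstCLM ℂ (-w) F - F - ∂_{w} F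
  have hR : sliceMap j (x + v) F - sliceMap j x F - sliceMap j x (∂_{w} F) = sliceMap j x R := by
    ext y
    simp only [sub_apply, sliceMap_apply, R, SchwartzMap.compSubConstCLM_apply,
      sub_neg_eq_add, hw]
    rw [← insert_add, add_zero]
  have hRd (z : Config d N) : iteratedFDeriv ℝ b R z = iteratedFDeriv ℝ b F (z + w) -
      iteratedFDeriv ℝ b F z - iteratedFDeriv ℝ b (∂_{w} F : Test d N) z := by
    have h1 : (R : Config d N → ℂ) = (fun z => F (z + w)) - F - (∂_{w} F : Test d N) := by
      funext z
      simp [R]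
    have hs : ContDiff ℝ b (fun z => F (z + w)) :=
      (F.smooth b).comp (contDiff_id.add contDiff_const)
    rw [h1, iteratedFDeriv_sub_apply, iteratedFDeriv_sub_apply, iteratedFDeriv_comp_add_right]
    · exact hs.contDiffAt
    · exact F.contDiffAt b
    · exact (hs.sub (F.smooth b)).contDiffAt
    · exact SchwartzMap.contDiffAt _ b
  rw [hR]
  refine SchwartzMap.seminorm_le_bound ℝ a b _ (by positivity) fun y => ?_
  refine (mul_le_mul_of_nonneg_left (norm_iteratedFDeriv_sliceMap_le j x R b y)
    (by positivity)).trans ?_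
  rw [hRd]
  have hwv : ‖w‖ ≤ ‖v‖ := norm_insert_zero_le_norm j v
  -- If the weight is nonzero it is divided out. The seminorm over ‖y‖ ^ a then bounds the
  -- derivative on the whole segment, since moving the frozen variables leaves the active ones equal
  -- to y.
  rcases (pow_nonneg (norm_nonneg y) a).eq_or_lt with h0 | h0
  · rw [← h0, zero_mul]
    positivity
  rw [mul_comm, ← le_div_iff₀ h0, mul_div_right_comm]
  refine (norm_iteratedFDeriv_taylor_le (M := SchwartzMap.seminorm ℝ a (b + 2) F / ‖y‖ ^ a)
    fun t _ => ?_).trans (by gcongr)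
  rw [le_div_iff₀ h0, mul_comm]
  have hz : insert j x y + t • w = insert j (x + t • v) y := by
    rw [hw, ← insert_smul, ← insert_add, smul_zero, add_zero]
  rw [hz]
  refine le_trans ?_ (SchwartzMap.le_seminorm ℝ a (b + 2) F (insert j (x + t • v) y))
  gcongr
  exact norm_le_norm_insert _ _ _

/-- The function `x ↦ (T F_{j, x})(x_{j_1}, …, x_{j_k})`. -/
def liftFun (j : Fin k ↪ Fin N) (T : Test d k →L[ℂ] Test d k) (F : Test d N) : Config d N → ℂ :=
  fun x => T (sliceMap j x F) (x ∘ j)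

/-- The weight in the active variables is absorbed by the decay of T(slice), that in the frozen
variables by the decay of the slices. The latter raises the first index of the seminorms by a. -/
theorem exists_weighted_bound_liftFun (j : Fin k ↪ Fin N) (T : Test d k →L[ℂ] Test d k) (a : ℕ) :
    ∃ (s : Finset (ℕ × ℕ)) (C : ℝ), 0 ≤ C ∧ ∀ F x, ‖x‖ ^ a * ‖liftFun j T F x‖ ≤
      C * ∑ n ∈ s, SchwartzMap.seminorm ℝ n.1 n.2 F := by
  classical
  obtain ⟨s, C, hC, h⟩ := exists_seminorm_map_le T a 0
  obtain ⟨s', C', hC', h'⟩ := exists_seminorm_map_le T 0 0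
  refine ⟨s ∪ s'.image fun n => (a + n.1, n.2), C + C', by positivity, fun F x => ?_⟩
  have h1 : ‖x ∘ j‖ ^ a * ‖liftFun j T F x‖ ≤ C * ∑ n ∈ s, SchwartzMap.seminorm ℝ n.1 n.2 F := by
    refine (SchwartzMap.norm_pow_mul_le_seminorm ℝ (T (sliceMap j x F)) a (x ∘ j)).trans
      ((h _).trans ?_)
    gcongr
    exact seminorm_sliceMap_le j x F _ _
  have h2 : ‖insert j x 0‖ ^ a * ‖liftFun j T F x‖ ≤
      C' * ∑ n ∈ s', SchwartzMap.seminorm ℝ (a + n.1) n.2 F := by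
    calc ‖insert j x 0‖ ^ a * ‖liftFun j T F x‖
        ≤ ‖insert j x 0‖ ^ a * (C' * ∑ n ∈ s', SchwartzMap.seminorm ℝ n.1 n.2
            (sliceMap j x F)) := by
          gcongr
          exact (SchwartzMap.norm_le_seminorm ℝ (T (sliceMap j x F)) (x ∘ j)).trans (h' _)
      _ = C' * ∑ n ∈ s', ‖insert j x 0‖ ^ a * SchwartzMap.seminorm ℝ n.1 n.2
            (sliceMap j x F) := by
          rw [← Finset.mul_sum]; ring
      _ ≤ _ := by
          gcongr
          exact pow_mul_seminorm_sliceMap_le j x F a _ _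
  have h3 : ∑ n ∈ s', SchwartzMap.seminorm ℝ (a + n.1) n.2 F =
      ∑ n ∈ s'.image fun n => (a + n.1, n.2), SchwartzMap.seminorm ℝ n.1 n.2 F := by
    rw [Finset.sum_image]
    rintro ⟨p, q⟩ _ ⟨p', q'⟩ _ hpq
    simp only [Prod.mk.injEq, add_right_inj] at hpq
    exact Prod.ext hpq.1 hpq.2
  rw [h3] at h2
  calc ‖x‖ ^ a * ‖liftFun j T F x‖
      ≤ (‖x ∘ j‖ ^ a + ‖insert j x 0‖ ^ a) * ‖liftFun j T F x‖ := by
        gcongr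
        refine (pow_le_pow_left₀ (norm_nonneg _) (norm_le_max_insert j x) a).trans ?_
        rcases max_choice ‖x ∘ j‖ ‖insert j x 0‖ with h | h <;> rw [h]
        · exact le_add_of_nonneg_right (by positivity)
        · exact le_add_of_nonneg_left (by positivity)
    _ ≤ C * ∑ n ∈ s, SchwartzMap.seminorm ℝ n.1 n.2 F + C' *
        ∑ n ∈ s'.image fun n => (a + n.1, n.2), SchwartzMap.seminorm ℝ n.1 n.2 F := by
        rw [add_mul]
        exact add_le_add h1 h2
    _ ≤ _ := by
        rw [add_mul]
        gcongr
        · exact Finset.subset_union_left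
        · exact Finset.subset_union_right

/-- The derivative of `liftFun j T F` at `x`. -/
def liftFunDeriv (j : Fin k ↪ Fin N) (T : Test d k →L[ℂ] Test d k) (F : Test d N)
    (x : Config d N) : Config d N →L[ℝ] ℂ :=
  LinearMap.toContinuousLinearMap
    { toFun := fun v => ∂_{v ∘ j} (T (sliceMap j x F)) (x ∘ j) +
        T (sliceMap j x (∂_{insert j v 0} F)) (x ∘ j)
      map_add' := fun v w => by
        have h1 : (v + w) ∘ j = v ∘ j + w ∘ j := rfl
        have h2 : insert j (v + w) (0 : Config d k) = insert j v 0 + insert j w 0 := by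
          rw [← insert_add, add_zero]
        rw [h1, h2, lineDerivOp_left_add, lineDerivOp_left_add, map_add, map_add, add_apply,
          add_apply]
        ring
      map_smul' := fun c v => by
        have h1 : (c • v) ∘ j = c • (v ∘ j) := rfl
        have h2 : insert j (c • v) (0 : Config d k) = c • insert j v 0 := by
          rw [← insert_smul, smul_zero]
        rw [h1, h2, lineDerivOp_left_smul, lineDerivOp_left_smul,
          (sliceMap j x).map_smul_of_tower, T.map_smul_of_tower, smul_apply, smul_apply, smul_add,
          RingHom.id_apply] }

theorem liftFunDeriv_apply (j : Fin k ↪ Fin N) (T : Test d k →L[ℂ] Test d k) (F : Test d N)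
    (x v : Config d N) : liftFunDeriv j T F x v =
      liftFun j (lineDerivOpCLM ℂ (Test d k) (v ∘ j) ∘L T) F x +
      liftFun j T (∂_{insert j v 0} F) x := rfl

/-- x enters twice, through the slice and through the evaluation point. Each dependence is
differentiable with quadratic remainder, and the mixed term is a product of two first-order
increments. -/
theorem exists_liftFun_taylor_bound (j : Fin k ↪ Fin N) (T : Test d k →L[ℂ] Test d k)
    (F : Test d N) (x : Config d N) : ∃ C, ∀ v,
      ‖liftFun j T F (x + v) - liftFun j T F x - liftFunDeriv j T F x v‖ ≤ C * ‖v‖ ^ 2 := by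
  obtain ⟨s, C, hC, h⟩ := exists_seminorm_map_le T 0 0
  obtain ⟨s', C', hC', h'⟩ := exists_seminorm_map_le T 0 1
  let u := T (sliceMap j x F)
  refine ⟨C * ∑ n ∈ s, SchwartzMap.seminorm ℝ n.1 (n.2 + 2) F +
    C' * ∑ n ∈ s', SchwartzMap.seminorm ℝ n.1 (n.2 + 1) F + SchwartzMap.seminorm ℝ 0 2 u,
    fun v => ?_⟩
  set w : Config d N := insert j v 0 with hw
  have hwv : ‖w‖ ≤ ‖v‖ := norm_insert_zero_le_norm j v
  have hvj : ‖v ∘ j‖ ≤ ‖v‖ := norm_comp_le j v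
  set R := sliceMap j (x + v) F - sliceMap j x F - sliceMap j x (∂_{w} F) with hR
  set g := T (sliceMap j x (∂_{w} F)) with hg
  have hxv : (x + v) ∘ j = x ∘ j + v ∘ j := rfl
  -- The three terms: T of the slice remainder at the moved point; the change of evaluation point in
  -- T(derivative slice); the Taylor remainder of the fixed function u.
  have e : liftFun j T F (x + v) - liftFun j T F x - liftFunDeriv j T F x v =
      T R (x ∘ j + v ∘ j) + (g (x ∘ j + v ∘ j) - g (x ∘ j)) +
      (u (x ∘ j + v ∘ j) - u (x ∘ j) - (∂_{v ∘ j} u : Test d k) (x ∘ j)) := by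
    have : liftFunDeriv j T F x v = (∂_{v ∘ j} u : Test d k) (x ∘ j) + g (x ∘ j) := rfl
    rw [this, hR, map_sub, map_sub, sub_apply, sub_apply, ← hg]
    simp only [liftFun, hxv, u]
    ring
  have h1 : ‖T R (x ∘ j + v ∘ j)‖ ≤
      C * ∑ n ∈ s, SchwartzMap.seminorm ℝ n.1 (n.2 + 2) F * ‖v‖ ^ 2 := by
    refine (SchwartzMap.norm_le_seminorm ℝ (T R) _).trans ((h R).trans ?_)
    gcongr
    exact seminorm_sliceMap_taylor_le j x v F _ _
  have h2 : ‖g (x ∘ j + v ∘ j) - g (x ∘ j)‖ ≤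
      (C' * ∑ n ∈ s', SchwartzMap.seminorm ℝ n.1 (n.2 + 1) F * ‖v‖) * ‖v‖ := by
    have hgb (y : Config d k) : ‖iteratedFDeriv ℝ 1 g y‖ ≤
        C' * ∑ n ∈ s', SchwartzMap.seminorm ℝ n.1 (n.2 + 1) F * ‖v‖ := by
      refine (SchwartzMap.norm_iteratedFDeriv_le_seminorm ℝ g 1 y).trans ((h' _).trans ?_)
      gcongr
      refine (seminorm_sliceMap_le j x _ _ _).trans ((seminorm_lineDeriv_le _ _ F w).trans ?_)
      gcongr
    have := norm_iteratedFDeriv_add_sub_le (n := 0) (f := g) (x := x ∘ j) (w := v ∘ j)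
      (fun t _ => hgb _) (t := 1) (by simp)
    rw [one_smul, iteratedFDeriv_zero_eq_comp] at this
    simp only [Function.comp_apply, ← map_sub, LinearIsometryEquiv.norm_map] at this
    refine this.trans ?_
    have hpos : 0 ≤ C' * ∑ n ∈ s', SchwartzMap.seminorm ℝ n.1 (n.2 + 1) F * ‖v‖ :=
      (norm_nonneg _).trans (hgb 0)
    gcongr
  have h3 : ‖u (x ∘ j + v ∘ j) - u (x ∘ j) - (∂_{v ∘ j} u : Test d k) (x ∘ j)‖ ≤
      SchwartzMap.seminorm ℝ 0 2 u * ‖v‖ ^ 2 := by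
    have := norm_iteratedFDeriv_taylor_le (n := 0) (f := u) (x := x ∘ j) (w := v ∘ j)
      (fun t _ => SchwartzMap.norm_iteratedFDeriv_le_seminorm ℝ u 2 _)
    rw [iteratedFDeriv_zero_eq_comp, iteratedFDeriv_zero_eq_comp] at this
    simp only [Function.comp_apply, ← map_sub, LinearIsometryEquiv.norm_map] at this
    refine this.trans ?_
    gcongr
  rw [e]
  refine (norm_add₃_le).trans ((add_le_add_three h1 h2 h3).trans_eq ?_)
  rw [← Finset.sum_mul, ← Finset.sum_mul]
  ring

theorem hasFDerivAt_liftFun (j : Fin k ↪ Fin N) (T : Test d k →L[ℂ] Test d k) (F : Test d N)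
    (x : Config d N) : HasFDerivAt (liftFun j T F) (liftFunDeriv j T F x) x := by
  obtain ⟨C, hC⟩ := exists_liftFun_taylor_bound j T F x
  rw [hasFDerivAt_iff_isLittleO_nhds_zero]
  refine (Asymptotics.IsBigO.of_bound C (Filter.Eventually.of_forall fun v => ?_) :
    _ =O[nhds 0] fun v : Config d N => ‖v‖ ^ 2).trans_isLittleO ?_
  · simpa using hC v
  · exact Asymptotics.isLittleO_norm_pow_id (by norm_num)

/-- A basis of the configuration space. -/
def cfgBasis (d N : ℕ) : Module.Basis (Fin (Module.finrank ℝ (Config d N))) ℝ (Config d N) :=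
  Module.finBasis ℝ (Config d N)

/-- The coordinates with respect to `cfgBasis`. -/
def cfgCoord (d N : ℕ) (i : Fin (Module.finrank ℝ (Config d N))) : Config d N →L[ℝ] ℝ :=
  LinearMap.toContinuousLinearMap ((cfgBasis d N).coord i)

/-- In coordinates the derivative is a finite combination of functions of the form `liftFun` for
other operators and other Schwartz functions. This closes the inductions below, which for that
reason quantify over T. -/
theorem fderiv_liftFun (j : Fin k ↪ Fin N) (T : Test d k →L[ℂ] Test d k) (F : Test d N) :
    fderiv ℝ (liftFun j T F) = fun x => ∑ i,
      (ContinuousLinearMap.smulRightL ℝ (Config d N) ℂ (cfgCoord d N i))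
        (liftFun j (lineDerivOpCLM ℂ (Test d k) (cfgBasis d N i ∘ j) ∘L T) F x +
          liftFun j T (∂_{insert j (cfgBasis d N i) 0} F) x) := by
  funext x
  rw [(hasFDerivAt_liftFun j T F x).fderiv]
  ext v
  rw [sum_apply]
  conv_lhs => rw [← (cfgBasis d N).sum_repr v, map_sum]
  refine Finset.sum_congr rfl fun i _ => ?_
  rw [map_smul, liftFunDeriv_apply]
  rfl

theorem contDiff_liftFun (j : Fin k ↪ Fin N) (n : ℕ) : ∀ (T : Test d k →L[ℂ] Test d k)
    (F : Test d N), ContDiff ℝ n (liftFun j T F) := by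
  induction n with
  | zero =>
    intro T F
    rw [Nat.cast_zero, contDiff_zero]
    exact continuous_iff_continuousAt.2 fun x => (hasFDerivAt_liftFun j T F x).continuousAt
  | succ n ih =>
    intro T F
    rw [Nat.cast_add, Nat.cast_one, contDiff_succ_iff_fderiv]
    refine ⟨fun x => (hasFDerivAt_liftFun j T F x).differentiableAt, by simp, ?_⟩
    rw [fderiv_liftFun]
    refine ContDiff.sum fun i _ => ?_
    exact (ContinuousLinearMap.contDiff _).comp ((ih _ _).add (ih _ _))

/-- Induction on n through the derivative formula. An abstract continuous seminorm is used because
it can be composed with the differentiation of F; finitely many Schwartz seminorms are extracted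
only in `lift`. -/
theorem exists_seminorm_bound_liftFun (j : Fin k ↪ Fin N) (a n : ℕ) :
    ∀ T : Test d k →L[ℂ] Test d k, ∃ q : Seminorm ℂ (Test d N), Continuous q ∧ ∀ F x,
      ‖x‖ ^ a * ‖iteratedFDeriv ℝ n (liftFun j T F) x‖ ≤ q F := by
  induction n with
  | zero =>
    intro T
    obtain ⟨s, C, hC, h⟩ := exists_weighted_bound_liftFun j T a
    lift C to NNReal using hC
    refine ⟨C • ∑ n ∈ s, (SchwartzMap.seminorm ℂ n.1 n.2 : Seminorm ℂ (Test d N)), ?_, fun F x => ?_⟩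
    · have : Continuous fun F : Test d N =>
          C * ∑ n ∈ s, SchwartzMap.seminorm ℂ n.1 n.2 F := by
        refine continuous_const.mul (continuous_finsetSum _ fun n _ => ?_)
        exact (schwartz_withSeminorms ℂ (Config d N) ℂ).continuous_seminorm n
      convert this using 2 with F
      rw [smul_apply, sum_apply]
      rfl
    · rw [norm_iteratedFDeriv_zero, smul_apply, sum_apply]
      exact h F x
  | succ n ih =>
    intro T
    obtain ⟨q', hq', h'⟩ := ih T
    choose q hq h using fun i =>
      ih (lineDerivOpCLM ℂ (Test d k) (cfgBasis d N i ∘ j) ∘L T)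
    let L := fun i => ContinuousLinearMap.smulRightL ℝ (Config d N) ℂ (cfgCoord d N i)
    let D := fun i => lineDerivOpCLM ℂ (Test d N) (insert j (cfgBasis d N i) (0 : Config d k))
    refine ⟨∑ i, ‖L i‖₊ • (q i + q'.comp (D i).toLinearMap), ?_, fun F x => ?_⟩
    · have : Continuous fun F : Test d N => ∑ i, ‖L i‖ * (q i F + q' (D i F)) :=
        continuous_finsetSum _ fun i _ => continuous_const.mul
          ((hq i).add (hq'.comp (D i).continuous))
      convert this using 2 with F
      rw [sum_apply]
      rfl
    · let g := fun i x =>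
        liftFun j (lineDerivOpCLM ℂ (Test d k) (cfgBasis d N i ∘ j) ∘L T) F x +
          liftFun j T (∂_{insert j (cfgBasis d N i) 0} F) x
      have hsm (i) : ContDiff ℝ n (g i) :=
        (contDiff_liftFun j n _ _).add (contDiff_liftFun j n _ _)
      have e : iteratedFDeriv ℝ n (fun x => ∑ i, L i (g i x)) x =
          ∑ i, iteratedFDeriv ℝ n (L i ∘ g i) x :=
        iteratedFDeriv_fun_sum_apply fun i _ => ((L i).contDiff.comp (hsm i)).contDiffAt
      rw [← norm_iteratedFDeriv_fderiv, fderiv_liftFun]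
      change ‖x‖ ^ a * ‖iteratedFDeriv ℝ n (fun x => ∑ i, L i (g i x)) x‖ ≤ _
      rw [e, sum_apply]
      refine (mul_le_mul_of_nonneg_left (norm_sum_le _ _) (by positivity)).trans ?_
      rw [Finset.mul_sum]
      refine Finset.sum_le_sum fun i _ => ?_
      have h1 := (L i).norm_iteratedFDeriv_comp_left (hsm i).contDiffAt (x := x) (n := n) le_rfl
      have h2 : iteratedFDeriv ℝ n (g i) x = _ :=
        iteratedFDeriv_add_apply (contDiff_liftFun j n _ _).contDiffAt
          (contDiff_liftFun j n _ _).contDiffAt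
      rw [h2] at h1
      calc ‖x‖ ^ a * _ ≤ ‖x‖ ^ a * _ := mul_le_mul_of_nonneg_left
            (h1.trans (mul_le_mul_of_nonneg_left (norm_add_le _ _) (norm_nonneg _)))
            (by positivity)
        _ = ‖L i‖ * (_ + _) := by rw [mul_left_comm, mul_add]
        _ ≤ ‖L i‖ * (q i F + q' (D i F)) := by
          gcongr
          · exact h i F x
          · exact h' (D i F) x

/-- The operator on functions of `N` particles which acts as `T` in the variables
`x_{j_1}, …, x_{j_k}` and as the identity in the others. -/
def lift (j : Fin k ↪ Fin N) (T : Test d k →L[ℂ] Test d k) : Test d N →L[ℂ] Test d N :=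
  SchwartzMap.mkCLM (liftFun j T)
    (fun F G x => by rw [liftFun, map_add, map_add, add_apply]; rfl)
    (fun c F x => by rw [liftFun, map_smul, map_smul, smul_apply]; rfl)
    (fun F => contDiff_infty.2 fun n => contDiff_liftFun j n T F)
    (fun n => by
      obtain ⟨q, hq, h⟩ := exists_seminorm_bound_liftFun j n.1 n.2 T
      obtain ⟨s, C, -, hs⟩ :=
        Seminorm.bound_of_continuous (schwartz_withSeminorms ℂ (Config d N) ℂ) q hq
      exact ⟨s, C, C.2, fun F x => (h F x).trans (hs F)⟩)

theorem lift_apply (j : Fin k ↪ Fin N) (T : Test d k →L[ℂ] Test d k) (F : Test d N)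
    (x : Config d N) : lift j T F x = T (sliceMap j x F) (x ∘ j) := rfl

end Lift

/-! ### Composition, permutation and skew-adjointness of lifts -/

section InnerProduct

variable {d k l N : ℕ}

theorem sliceMap_insert (j : Fin k ↪ Fin N) (x : Config d N) (y : Config d k) (F : Test d N) :
    sliceMap j (insert j x y) F = sliceMap j x F := by
  ext z
  rw [sliceMap_apply, sliceMap_apply, insert_insert]

/-- T does not alter the frozen variables, so a lift acts slice by slice as T. Multiplicativity and
skewness of lifts reduce to this. -/
theorem sliceMap_lift (j : Fin k ↪ Fin N) (x : Config d N) (T : Test d k →L[ℂ] Test d k)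
    (F : Test d N) : sliceMap j x (lift j T F) = T (sliceMap j x F) := by
  ext y
  rw [sliceMap_apply, lift_apply, sliceMap_insert, insert_comp]

theorem lift_comp (j : Fin k ↪ Fin N) (S T : Test d k →L[ℂ] Test d k) :
    lift j (S ∘L T) = lift j S ∘L lift j T := by
  ext F x
  rw [ContinuousLinearMap.comp_apply, lift_apply, lift_apply, sliceMap_lift]
  rfl

theorem lift_add (j : Fin k ↪ Fin N) (S T : Test d k →L[ℂ] Test d k) :
    lift j (S + T) = lift j S + lift j T := rfl

theorem lift_sub (j : Fin k ↪ Fin N) (S T : Test d k →L[ℂ] Test d k) :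
    lift j (S - T) = lift j S - lift j T := rfl

theorem lift_smul (j : Fin k ↪ Fin N) (c : ℂ) (T : Test d k →L[ℂ] Test d k) :
    lift j (c • T) = c • lift j T := rfl

theorem lift_sum {ι : Type*} (s : Finset ι) (j : Fin k ↪ Fin N)
    (T : ι → Test d k →L[ℂ] Test d k) : lift j (∑ i ∈ s, T i) = ∑ i ∈ s, lift j (T i) :=
  map_sum (AddMonoidHom.mk' (lift j : (Test d k →L[ℂ] Test d k) → _) (lift_add j)) T s

theorem insert_insert_comp (e : Fin k ↪ Fin N) (a : Fin l ↪ Fin k) (x : Config d N)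
    (y : Config d l) : insert e x (insert a (x ∘ e) y) = insert (a.trans e) x y := by
  funext n
  by_cases hn : n ∈ Set.range e
  · obtain ⟨i, rfl⟩ := hn
    rw [insert_apply_self]
    by_cases hi : i ∈ Set.range a
    · obtain ⟨m, rfl⟩ := hi
      rw [insert_apply_self]
      exact (insert_apply_self (a.trans e) x y m).symm
    · rw [insert_apply_of_notMem _ _ _ hi, insert_apply_of_notMem]
      · rfl
      · rintro ⟨m, hm⟩
        exact hi ⟨m, e.injective hm⟩
  · rw [insert_apply_of_notMem _ _ _ hn, insert_apply_of_notMem]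
    rintro ⟨m, rfl⟩
    exact hn ⟨a m, rfl⟩

/-- Lifting in stages: this is what relates commutators on m particles to commutators on N
particles. -/
theorem lift_lift (e : Fin k ↪ Fin N) (a : Fin l ↪ Fin k) (T : Test d l →L[ℂ] Test d l) :
    lift e (lift a T) = lift (a.trans e) T := by
  ext F x
  rw [lift_apply, lift_apply, lift_apply]
  have : sliceMap a (x ∘ e) (sliceMap e x F) = sliceMap (a.trans e) x F := by
    ext y
    rw [sliceMap_apply, sliceMap_apply, sliceMap_apply, insert_insert_comp]
  rw [this]
  rfl

/-- Permutation of the variables. -/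
def permute (σ : Equiv.Perm (Fin N)) : Test d N →L[ℂ] Test d N :=
  SchwartzMap.compCLMOfContinuousLinearEquiv ℂ
    (LinearEquiv.funCongrLeft ℝ (EuclideanSpace ℝ (Fin d)) σ).toContinuousLinearEquiv

theorem permute_apply (σ : Equiv.Perm (Fin N)) (F : Test d N) (x : Config d N) :
    permute σ F x = F (x ∘ σ) := rfl

theorem mem_bosonic_iff {F : Test d N} : F ∈ bosonic d N ↔ ∀ σ, permute σ F = F :=
  ⟨fun h σ => SchwartzMap.ext fun x => h σ x, fun h σ x => by
    conv_rhs => rw [← h σ]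
    rfl⟩

theorem insert_comp_equiv (j : Fin k ↪ Fin N) (σ : Equiv.Perm (Fin N)) (x : Config d N)
    (y : Config d k) :
    insert j x y ∘ σ = insert (j.trans σ⁻¹.toEmbedding) (x ∘ σ) y := by
  funext n
  by_cases hn : σ n ∈ Set.range j
  · obtain ⟨i, hi⟩ := hn
    have : n = (j.trans σ⁻¹.toEmbedding) i := by
      simp [hi]
    rw [Function.comp_apply, ← hi, insert_apply_self, this, insert_apply_self]
  · rw [Function.comp_apply, insert_apply_of_notMem _ _ _ hn, insert_apply_of_notMem]
    · rfl
    · rintro ⟨i, rfl⟩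
      exact hn ⟨i, by simp⟩

theorem lift_permute (j : Fin k ↪ Fin N) (σ : Equiv.Perm (Fin N))
    (T : Test d k →L[ℂ] Test d k) (F : Test d N) :
    lift j T (permute σ F) = permute σ (lift (j.trans σ⁻¹.toEmbedding) T F) := by
  ext x
  rw [permute_apply, lift_apply, lift_apply]
  have h1 : sliceMap j x (permute σ F) = sliceMap (j.trans σ⁻¹.toEmbedding) (x ∘ σ) F := by
    ext y
    rw [sliceMap_apply, sliceMap_apply, permute_apply, insert_comp_equiv]
  have h2 : x ∘ j = (x ∘ σ) ∘ (j.trans σ⁻¹.toEmbedding) := by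
    funext i
    simp
  rw [h1, h2]

/-- Symmetrization of a Schwartz function. -/
def symmetrize (d N : ℕ) : Test d N →L[ℂ] Bosonic d N :=
  ((N.factorial : ℂ)⁻¹ • ∑ σ : Equiv.Perm (Fin N), permute σ).codRestrict (bosonic d N)
    fun F => by
      rw [smul_apply, sum_apply]
      refine (bosonic d N).smul_mem _ (mem_bosonic_iff.2 fun τ => ?_)
      rw [map_sum]
      refine Fintype.sum_equiv (Equiv.mulLeft τ) _ _ fun σ => ?_
      rfl

theorem symmetrize_val (F : Test d N) :
    (symmetrize d N F).1 = (N.factorial : ℂ)⁻¹ • ∑ σ : Equiv.Perm (Fin N), permute σ F := by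
  change ((N.factorial : ℂ)⁻¹ • ∑ σ : Equiv.Perm (Fin N), permute σ : _ →L[ℂ] _) F = _
  rw [smul_apply, sum_apply]

theorem symmetrize_coe (f : Bosonic d N) : symmetrize d N f.1 = f := by
  apply Subtype.ext
  rw [symmetrize_val, Finset.sum_congr rfl fun σ _ => mem_bosonic_iff.1 f.2 σ,
    Finset.sum_const, Finset.card_univ, Fintype.card_perm, Fintype.card_fin,
    ← Nat.cast_smul_eq_nsmul ℂ, smul_smul,
    inv_mul_cancel₀ (Nat.cast_ne_zero.2 N.factorial_ne_zero), one_smul]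

/-- The `L²` inner product of Schwartz functions. -/
def ip (F G : Test d N) : ℂ := ∫ x, (starRingEnd ℂ) (F x) * G x

theorem l2Inner_eq_ip (f g : Bosonic d N) : l2Inner f g = ip f.1 g.1 := rfl

theorem integrable_ip (F G : Test d N) :
    MeasureTheory.Integrable fun x => (starRingEnd ℂ) (F x) * G x := by
  refine G.integrable.bdd_mul (c := SchwartzMap.seminorm ℝ 0 0 F) ?_ ?_
  · exact (Complex.continuous_conj.comp F.continuous).aestronglyMeasurable
  · refine Filter.Eventually.of_forall fun x => ?_
    rw [RCLike.norm_conj]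
    exact SchwartzMap.norm_le_seminorm ℝ F x

theorem ip_add_left (F F' G : Test d N) : ip (F + F') G = ip F G + ip F' G := by
  rw [ip, ip, ip, ← MeasureTheory.integral_add (integrable_ip F G) (integrable_ip F' G)]
  simp [add_mul]

theorem ip_add_right (F G G' : Test d N) : ip F (G + G') = ip F G + ip F G' := by
  rw [ip, ip, ip, ← MeasureTheory.integral_add (integrable_ip F G) (integrable_ip F G')]
  simp [mul_add]

theorem ip_smul_left (c : ℂ) (F G : Test d N) : ip (c • F) G = (starRingEnd ℂ) c * ip F G := by
  rw [ip, ip, ← MeasureTheory.integral_const_mul]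
  simp [mul_assoc]

theorem ip_smul_right (c : ℂ) (F G : Test d N) : ip F (c • G) = c * ip F G := by
  rw [ip, ip, ← MeasureTheory.integral_const_mul]
  simp [mul_left_comm]

theorem ip_sum_left {ι : Type*} (s : Finset ι) (F : ι → Test d N) (G : Test d N) :
    ip (∑ i ∈ s, F i) G = ∑ i ∈ s, ip (F i) G :=
  map_sum (AddMonoidHom.mk' (fun F => ip F G) fun F F' => ip_add_left F F' G) F s

theorem ip_sum_right {ι : Type*} (s : Finset ι) (F : Test d N) (G : ι → Test d N) :
    ip F (∑ i ∈ s, G i) = ∑ i ∈ s, ip F (G i) :=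
  map_sum (AddMonoidHom.mk' (fun G => ip F G) fun G G' => ip_add_right F G G') G s

theorem ip_sub_left (F F' G : Test d N) : ip (F - F') G = ip F G - ip F' G :=
  map_sub (AddMonoidHom.mk' (fun F => ip F G) fun F F' => ip_add_left F F' G) F F'

theorem ip_sub_right (F G G' : Test d N) : ip F (G - G') = ip F G - ip F G' :=
  map_sub (AddMonoidHom.mk' (fun G => ip F G) fun G G' => ip_add_right F G G') G G'

theorem eq_zero_of_ip_self {F : Test d N} (h : ip F F = 0) : F = 0 := by
  have h2 : (fun x => (starRingEnd ℂ) (F x) * F x) = fun x => ((‖F x‖ ^ 2 : ℝ) : ℂ) := by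
    funext x
    rw [RCLike.conj_mul]
    simp
  rw [ip, h2, integral_complex_ofReal, Complex.ofReal_eq_zero,
    MeasureTheory.integral_eq_zero_iff_of_nonneg (fun x => sq_nonneg ‖F x‖)] at h
  · have hc : Continuous fun x => ‖F x‖ ^ 2 := F.continuous.norm.pow 2
    have := (hc.ae_eq_iff_eq MeasureTheory.volume continuous_const).1 h
    ext x
    have h3 : ‖F x‖ ^ 2 = 0 := congrFun this x
    simpa using h3
  · have := (integrable_ip F F).norm
    refine this.congr (Filter.Eventually.of_forall fun x => ?_)
    simp [sq]

theorem ip_permute (σ : Equiv.Perm (Fin N)) (F G : Test d N) :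
    ip (permute σ F) (permute σ G) = ip F G := by
  have h := (MeasureTheory.volume_measurePreserving_piCongrLeft
    (fun _ : Fin N => EuclideanSpace ℝ (Fin d)) σ).symm
  exact h.integral_comp' (g := fun x => (starRingEnd ℂ) (F x) * G x)

theorem ip_permute_left (σ : Equiv.Perm (Fin N)) (F G : Test d N) :
    ip (permute σ F) G = ip F (permute σ⁻¹ G) := by
  rw [← ip_permute σ⁻¹ (permute σ F) G]
  congr 1
  ext x
  rw [permute_apply, permute_apply]
  congr 1
  funext i
  simp

theorem ip_symmetrize_left (F G : Test d N) :
    ip (symmetrize d N F).1 G = ip F (symmetrize d N G).1 := by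
  rw [symmetrize_val, symmetrize_val, ip_smul_left, ip_smul_right, ip_sum_left, ip_sum_right]
  simp only [map_inv₀, Complex.conj_natCast]
  congr 1
  refine Fintype.sum_equiv (Equiv.inv _) _ _ fun σ => ?_
  exact ip_permute_left σ F G

theorem ip_symmetrize_coe (F : Test d N) (g : Bosonic d N) :
    ip (symmetrize d N F).1 g.1 = ip F g.1 := by
  rw [ip_symmetrize_left, symmetrize_coe]

theorem ip_coe_symmetrize (f : Bosonic d N) (G : Test d N) :
    ip f.1 (symmetrize d N G).1 = ip f.1 G := by
  rw [← ip_symmetrize_left, symmetrize_coe]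

/-- Skew-adjointness of an operator on Schwartz functions. -/
def IsSkew (T : Test d N →L[ℂ] Test d N) : Prop := ∀ F G, ip (T F) G = -ip F (T G)

theorem IsSkew.real_smul {T : Test d N →L[ℂ] Test d N} (hT : IsSkew T) (c : ℝ) :
    IsSkew ((c : ℂ) • T) := fun F G => by
  rw [smul_apply, smul_apply, ip_smul_left, ip_smul_right, hT, Complex.conj_ofReal]
  ring

theorem IsSkew.sum {ι : Type*} (s : Finset ι) {T : ι → Test d N →L[ℂ] Test d N}
    (hT : ∀ i ∈ s, IsSkew (T i)) : IsSkew (∑ i ∈ s, T i) := fun F G => by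
  rw [sum_apply, sum_apply, ip_sum_left, ip_sum_right, ← Finset.sum_neg_distrib]
  exact Finset.sum_congr rfl fun i hi => hT i hi F G

theorem IsSkew.commutator {S T : Test d N →L[ℂ] Test d N} (hS : IsSkew S) (hT : IsSkew T) :
    IsSkew (S ∘L T - T ∘L S) := fun F G => by
  simp only [sub_apply, ContinuousLinearMap.comp_apply, ip_sub_left, ip_sub_right]
  rw [hS, hT, hT, hS]
  ring

/-- Extension by zero of a configuration of the particles outside the range of `j`. -/
def extendRest (j : Fin k ↪ Fin N)
    (z : ((Set.range j)ᶜ : Set (Fin N)) → EuclideanSpace ℝ (Fin d)) : Config d N :=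
  open Classical in fun a => if h : a ∈ (Set.range j)ᶜ then z ⟨a, h⟩ else 0

/-- Fubini for the splitting of the coordinates into the range of j and its complement. The zeros of
`extendRest` on the range are overwritten by `insert`. -/
theorem integral_eq_integral_insert (j : Fin k ↪ Fin N) (H : Config d N → ℂ)
    (hH : MeasureTheory.Integrable H) :
    ∫ x, H x = ∫ z, ∫ y, H (insert j (extendRest j z) y) := by
  classical
  let e : Fin k ⊕ ((Set.range j)ᶜ : Set (Fin N)) ≃ Fin N :=
    ((Equiv.ofInjective j j.injective).sumCongr (Equiv.refl _)).trans
      (Equiv.Set.sumCompl (Set.range j))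
  let E := EuclideanSpace ℝ (Fin d)
  let Φ := (MeasurableEquiv.sumPiEquivProdPi
    (fun _ : Fin k ⊕ ((Set.range j)ᶜ : Set (Fin N)) => E)).symm.trans
      (MeasurableEquiv.piCongrLeft (fun _ : Fin N => E) e)
  have hΦ : MeasureTheory.MeasurePreserving Φ :=
    (MeasureTheory.volume_measurePreserving_piCongrLeft (fun _ : Fin N => E) e).comp
      (MeasureTheory.volume_measurePreserving_sumPiEquivProdPi
        (fun _ : Fin k ⊕ ((Set.range j)ᶜ : Set (Fin N)) => E)).symm
  have hval (y : Config d k) (z) : Φ (y, z) = insert j (extendRest j z) y := by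
    funext a
    obtain ⟨b, rfl⟩ := e.surjective a
    have h1 : Φ (y, z) (e b) = Sum.elim y z b := by
      change (MeasurableEquiv.piCongrLeft (fun _ : Fin N => E) e) _ (e b) = _
      rw [MeasurableEquiv.coe_piCongrLeft, Equiv.piCongrLeft_apply_apply]
      cases b <;> rfl
    rw [h1]
    rcases b with i | ⟨a, ha⟩
    · have : e (Sum.inl i) = j i := rfl
      rw [this, insert_apply_self]
      rfl
    · have : e (Sum.inr ⟨a, ha⟩) = a := rfl
      rw [this, insert_apply_of_notMem _ _ _ ha, extendRest, dif_pos ha]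
      rfl
  rw [← hΦ.integral_comp' (g := H)]
  have hint : MeasureTheory.Integrable (fun p => H (Φ p)) :=
    (hΦ.integrable_comp_emb Φ.measurableEmbedding).2 hH
  refine (MeasureTheory.integral_prod_symm _ hint).trans ?_
  simp only [hval]
  rfl

theorem ip_eq_integral_slices (j : Fin k ↪ Fin N) (F G : Test d N) :
    ip F G = ∫ z, ip (sliceMap j (extendRest j z) F) (sliceMap j (extendRest j z) G) :=
  integral_eq_integral_insert j _ (integrable_ip F G)

/-- The inner product is an integral over slices, and on each slice the lift is the skew operator T.
-/
theorem IsSkew.lift {T : Test d k →L[ℂ] Test d k} (hT : IsSkew T) (j : Fin k ↪ Fin N) :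
    IsSkew (lift j T) := fun F G => by
  rw [ip_eq_integral_slices j, ip_eq_integral_slices j, ← MeasureTheory.integral_neg]
  congr 1
  funext z
  rw [sliceMap_lift, sliceMap_lift, hT]

/-- The operator of an observable, composed with the symmetrization. -/
def Observable.ext {d k : ℕ} (A : Observable d k) : Test d k →L[ℂ] Test d k :=
  (bosonic d k).subtypeL ∘L A.op ∘L symmetrize d k

theorem Observable.ext_apply (A : Observable d k) (F : Test d k) :
    A.ext F = (A.op (symmetrize d k F)).1 := rfl

theorem Observable.ext_coe (A : Observable d k) (f : Bosonic d k) : A.ext f.1 = (A.op f).1 := by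
  rw [Observable.ext_apply, symmetrize_coe]

/-- Symmetrization is a self-adjoint projection onto the bosonic functions, so it can be dropped
against a bosonic entry. -/
theorem Observable.isSkew_ext (A : Observable d k) : IsSkew A.ext := fun F G => by
  rw [A.ext_apply, A.ext_apply, ← ip_coe_symmetrize, ← l2Inner_eq_ip, A.skew, l2Inner_eq_ip,
    ip_symmetrize_coe]

/-- The observable obtained by symmetrizing a skew-adjoint operator. -/
def Observable.ofSkew (T : Test d k →L[ℂ] Test d k) (hT : IsSkew T) : Observable d k :=
  ⟨symmetrize d k ∘L T ∘L (bosonic d k).subtypeL, fun f g => by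
    change ip (symmetrize d k (T f.1)).1 g.1 = -ip f.1 (symmetrize d k (T g.1)).1
    rw [ip_symmetrize_coe, ip_coe_symmetrize, hT]⟩

theorem Observable.ofSkew_op (T : Test d k →L[ℂ] Test d k) (hT : IsSkew T) (f : Bosonic d k) :
    (Observable.ofSkew T hT).op f = symmetrize d k (T f.1) := rfl

theorem Observable.ofSkew_op_val {T : Test d k →L[ℂ] Test d k} (hT : IsSkew T) (f : Bosonic d k)
    (h : T f.1 ∈ bosonic d k) : ((Observable.ofSkew T hT).op f).1 = T f.1 := by
  have := symmetrize_coe ⟨T f.1, h⟩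
  rw [Observable.ofSkew_op, this]

theorem Observable.op_injective : Function.Injective (Observable.op : Observable d k → _) :=
  Subtype.val_injective

theorem Observable.ext_of_op {A B : Observable d k} (h : ∀ f x, (A.op f).1 x = (B.op f).1 x) :
    A = B :=
  Observable.op_injective (ContinuousLinearMap.ext fun f =>
    Subtype.ext (SchwartzMap.ext fun x => h f x))

/-- Slices of bosonic functions are bosonic, so the symmetrization inside `A.ext` has no effect on
them. -/
theorem extension_eq_lift (A : Observable d k) (j : Fin k ↪ Fin N) (f : Bosonic d N) :
    extension A j f = lift j A.ext f.1 := by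
  funext x
  rw [lift_apply, ← slice_val, A.ext_coe]
  rfl

end InnerProduct

/-! ### Tensor products as test functions, commuting lifts and polarization -/

section Tensor

open scoped ContDiff

variable {d k l N : ℕ}

/-- The smooth compactly supported functions of one particle. -/
def smoothCompact (d : ℕ) : Submodule ℂ (EuclideanSpace ℝ (Fin d) → ℂ) where
  carrier := {p | ContDiff ℝ ∞ p ∧ HasCompactSupport p}
  zero_mem' := ⟨contDiff_const, HasCompactSupport.zero⟩
  add_mem' := fun hp hq => ⟨hp.1.add hq.1, hp.2.add hq.2⟩
  smul_mem' := fun c _ hp => ⟨contDiff_const.smul hp.1, hp.2.smul_left (f := fun _ => c)⟩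

/-- The tensor product `p_1(x_1) ⋯ p_N(x_N)` of smooth compactly supported functions. -/
def tensor (p : Fin N → smoothCompact d) : Test d N :=
  HasCompactSupport.toSchwartzMap (f := fun x => ∏ n, (p n).1 (x n))
    (HasCompactSupport.intro (isCompact_univ_pi fun n => (p n).2.2) fun x hx => by
      simp only [Set.mem_pi, Set.mem_univ, true_implies, not_forall] at hx
      obtain ⟨n, hn⟩ := hx
      exact Finset.prod_eq_zero (Finset.mem_univ n) (image_eq_zero_of_notMem_tsupport hn))
    (contDiff_prod fun n _ => (p n).2.1.comp (contDiff_apply ℝ _ n))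

theorem tensor_apply (p : Fin N → smoothCompact d) (x : Config d N) :
    tensor p x = ∏ n, (p n).1 (x n) := rfl

theorem permute_tensor (σ : Equiv.Perm (Fin N)) (p : Fin N → smoothCompact d) :
    permute σ (tensor p) = tensor fun n => p (σ⁻¹ n) := by
  ext x
  rw [permute_apply, tensor_apply, tensor_apply]
  refine Fintype.prod_equiv σ _ _ fun n => ?_
  simp

/-- A Schwartz function which is orthogonal to all tensor products vanishes. -/
theorem eq_zero_of_ip_tensor {H : Test d N} (h : ∀ p, ip (tensor p) H = 0) : H = 0 := by
  by_contra hH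
  obtain ⟨a, ha⟩ : ∃ a, H a ≠ 0 := by
    by_contra! h0
    exact hH (SchwartzMap.ext h0)
  -- H is tested against a product of bumps around a point a with H a ≠ 0; near a the function g is
  -- positive.
  let g : Config d N → ℝ := fun x => ((starRingEnd ℂ) (H a) * H x).re
  have hg : Continuous g :=
    Complex.continuous_re.comp (continuous_const.mul H.continuous)
  have hga : 0 < g a := by
    simp only [g, ← Complex.normSq_eq_conj_mul_self, Complex.ofReal_re]
    exact Complex.normSq_pos.2 ha
  obtain ⟨ε, hε, hball⟩ := Metric.isOpen_iff.1 (isOpen_Ioi.preimage hg) a hga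
  -- The outer radius ε / 2 makes the product of the bumps vanish off the sup-norm ball of radius ε,
  -- on which g is positive.
  let b : ∀ n, ContDiffBump (a n) := fun n => ⟨ε / 3, ε / 2, by positivity, by linarith⟩
  let p : Fin N → smoothCompact d := fun n => ⟨fun y => ((b n y : ℝ) : ℂ),
    Complex.ofRealCLM.contDiff.comp (b n).contDiff,
    (b n).hasCompactSupport.comp_left Complex.ofReal_zero⟩
  let P : Config d N → ℝ := fun x => ∏ n, b n (x n)
  have hP (x) : tensor p x = (P x : ℂ) := by
    rw [tensor_apply]
    simp [p, P]
  have hP0 (x) : 0 ≤ P x := Finset.prod_nonneg fun n _ => (b n).nonneg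
  have hPc : Continuous P := continuous_finsetProd _ fun n _ =>
    (b n).continuous.comp (continuous_apply n)
  have hPs : HasCompactSupport P := by
    refine HasCompactSupport.intro (isCompact_univ_pi fun n => (b n).hasCompactSupport)
      fun x hx => ?_
    simp only [Set.mem_pi, Set.mem_univ, true_implies, not_forall] at hx
    obtain ⟨n, hn⟩ := hx
    exact Finset.prod_eq_zero (Finset.mem_univ n) (image_eq_zero_of_notMem_tsupport hn)
  have hpos : 0 < ∫ x, P x * g x := by
    refine (hPc.mul hg).integral_pos_of_hasCompactSupport_nonneg_nonzero (x := a) hPs.mul_right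
      (fun x => ?_) ?_
    · by_cases hx : x ∈ Metric.ball a ε
      · exact mul_nonneg (hP0 x) (le_of_lt (hball hx))
      · have : P x = 0 := by
          rw [Metric.mem_ball, dist_pi_lt_iff hε] at hx
          push Not at hx
          obtain ⟨n, hn⟩ := hx
          refine Finset.prod_eq_zero (Finset.mem_univ n) ((b n).zero_of_le_dist ?_)
          exact le_trans (by change ε / 2 ≤ ε; linarith) hn
        simp [this]
    · refine mul_ne_zero ?_ hga.ne'
      exact Finset.prod_ne_zero_iff.2 fun n _ => by
        rw [(b n).one_of_mem_closedBall]
        · exact one_ne_zero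
        · exact Metric.mem_closedBall_self (by change 0 ≤ ε / 3; positivity)
  have h1 : ∫ x, P x * g x = ((starRingEnd ℂ) (H a) * ip (tensor p) H).re := by
    rw [ip, ← MeasureTheory.integral_const_mul, ← RCLike.re_eq_complex_re, ← integral_re]
    · congr 1
      funext x
      rw [hP, Complex.conj_ofReal, mul_left_comm, RCLike.re_eq_complex_re,
        Complex.re_ofReal_mul]
    · exact (integrable_ip _ _).const_mul _
  rw [h1, h p, mul_zero, Complex.zero_re] at hpos
  exact lt_irrefl _ hpos

theorem sliceMap_tensor (j : Fin k ↪ Fin N) (x : Config d N) (p : Fin N → smoothCompact d) :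
    sliceMap j x (tensor p) =
      (∏ n ∈ (Finset.univ.map j)ᶜ, (p n).1 (x n)) • tensor (p ∘ j) := by
  ext y
  rw [sliceMap_apply, tensor_apply, smul_apply, tensor_apply, smul_eq_mul, mul_comm,
    ← Finset.prod_mul_prod_compl (Finset.univ.map j), Finset.prod_map]
  congr 1
  · refine Finset.prod_congr rfl fun i _ => ?_
    rw [insert_apply_self]
    rfl
  · refine Finset.prod_congr rfl fun n hn => ?_
    rw [insert_apply_of_notMem]
    simpa using hn

theorem lift_tensor (j : Fin k ↪ Fin N) (T : Test d k →L[ℂ] Test d k)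
    (p : Fin N → smoothCompact d) (x : Config d N) :
    lift j T (tensor p) x =
      (∏ n ∈ (Finset.univ.map j)ᶜ, (p n).1 (x n)) * T (tensor (p ∘ j)) (x ∘ j) := by
  rw [lift_apply, sliceMap_tensor, map_smul, smul_apply, smul_eq_mul]

theorem lift_lift_tensor {i : Fin k ↪ Fin N} {j : Fin l ↪ Fin N}
    (hij : Disjoint (Finset.univ.map i) (Finset.univ.map j)) (S : Test d k →L[ℂ] Test d k)
    (T : Test d l →L[ℂ] Test d l) (p : Fin N → smoothCompact d) (x : Config d N) :
    lift i S (lift j T (tensor p)) x =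
      (∏ n ∈ (Finset.univ.map i ∪ Finset.univ.map j)ᶜ, (p n).1 (x n)) *
        T (tensor (p ∘ j)) (x ∘ j) * S (tensor (p ∘ i)) (x ∘ i) := by
  have h : sliceMap i x (lift j T (tensor p)) =
      ((∏ n ∈ (Finset.univ.map i ∪ Finset.univ.map j)ᶜ, (p n).1 (x n)) *
        T (tensor (p ∘ j)) (x ∘ j)) • tensor (p ∘ i) := by
    ext y
    rw [sliceMap_apply, lift_tensor, smul_apply, tensor_apply, smul_eq_mul]
    have h1 : insert i x y ∘ j = x ∘ j := by
      funext m
      refine insert_apply_of_notMem _ _ _ ?_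
      rintro ⟨m', hm'⟩
      exact Finset.disjoint_left.1 hij (Finset.mem_map_of_mem i (Finset.mem_univ m'))
        (hm' ▸ Finset.mem_map_of_mem j (Finset.mem_univ m))
    have h2 : (Finset.univ.map j)ᶜ =
        Finset.univ.map i ∪ (Finset.univ.map i ∪ Finset.univ.map j)ᶜ := by
      ext n
      have h3 : n ∈ Finset.univ.map i → n ∉ Finset.univ.map j :=
        fun h => Finset.disjoint_left.1 hij h
      simp only [Finset.mem_compl, Finset.mem_union]
      tauto
    rw [h1, h2, Finset.prod_union, Finset.prod_map]
    · have e1 : ∏ m, (p (i m)).1 (insert i x y (i m)) = ∏ m, ((p ∘ i) m).1 (y m) :=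
        Finset.prod_congr rfl fun m _ => by rw [insert_apply_self]; rfl
      have e2 : ∏ n ∈ (Finset.univ.map i ∪ Finset.univ.map j)ᶜ, (p n).1 (insert i x y n) =
          ∏ n ∈ (Finset.univ.map i ∪ Finset.univ.map j)ᶜ, (p n).1 (x n) :=
        Finset.prod_congr rfl fun n hn => by
          rw [insert_apply_of_notMem]
          simp only [Finset.mem_compl, Finset.mem_union, Finset.mem_map, Finset.mem_univ,
            true_and, not_or] at hn
          exact hn.1
      rw [e1, e2]
      ring
    · exact Finset.disjoint_left.2 fun n hn hn' =>
        Finset.mem_compl.1 hn' (Finset.mem_union_left _ hn)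
  rw [lift_apply, h, map_smul, smul_apply, smul_eq_mul]

/-- On tensor products both orders give the same explicit product. No density in the Schwartz
topology is needed: skewness transfers both operators to the tensor product, and tensor products
separate Schwartz functions under the inner product. -/
theorem lift_comp_comm {i : Fin k ↪ Fin N} {j : Fin l ↪ Fin N}
    (hij : Disjoint (Finset.univ.map i) (Finset.univ.map j)) {S : Test d k →L[ℂ] Test d k}
    {T : Test d l →L[ℂ] Test d l} (hS : IsSkew S) (hT : IsSkew T) :
    lift i S ∘L lift j T = lift j T ∘L lift i S := by
  ext1 F
  rw [← sub_eq_zero]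
  refine eq_zero_of_ip_tensor fun p => ?_
  rw [ip_sub_right, ContinuousLinearMap.comp_apply, ContinuousLinearMap.comp_apply, sub_eq_zero]
  have hS' := hS.lift i
  have hT' := hT.lift j
  have e : lift j T (lift i S (tensor p)) = lift i S (lift j T (tensor p)) := by
    ext x
    rw [lift_lift_tensor hij, lift_lift_tensor hij.symm, Finset.union_comm]
    ring
  -- Moving two operators across the inner product costs two signs and reverses their order.
  rw [← neg_neg (ip (tensor p) (lift i S (lift j T F))), ← hS', ← hT',
    ← neg_neg (ip (tensor p) (lift j T (lift i S F))), ← hT', ← hS', e]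

/-- Ryser's formula for the permanent, by inclusion-exclusion: after expanding the product over maps
φ, the alternating sum over sets U that miss the image of φ vanishes unless φ is onto, hence
bijective. -/
theorem sum_perm_prod_eq {ι R : Type*} [Fintype ι] [DecidableEq ι] [CommRing R]
    (a : ι → ι → R) : ∑ σ : Equiv.Perm ι, ∏ m, a (σ m) m =
      ∑ U : Finset ι, (-1) ^ U.card * ∏ m, ∑ i ∈ Uᶜ, a i m := by
  have h1 (U : Finset ι) : ∏ m, ∑ i ∈ Uᶜ, a i m =
      ∑ φ : ι → ι, if ∀ m, φ m ∈ Uᶜ then ∏ m, a (φ m) m else 0 := by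
    rw [Finset.prod_univ_sum, ← Finset.sum_filter]
    refine Finset.sum_congr ?_ fun _ _ => rfl
    ext φ
    simp
  have h2 (φ : ι → ι) : ∑ U : Finset ι, (-1) ^ U.card *
      (if ∀ m, φ m ∈ Uᶜ then ∏ m, a (φ m) m else 0) =
        if Function.Bijective φ then ∏ m, a (φ m) m else 0 := by
    have h3 : ∑ U : Finset ι, (-1) ^ U.card *
        (if ∀ m, φ m ∈ Uᶜ then ∏ m, a (φ m) m else 0) =
        (∑ U ∈ (Finset.univ.image φ)ᶜ.powerset, (-1 : R) ^ U.card) * ∏ m, a (φ m) m := by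
      rw [Finset.sum_mul]
      simp only [mul_ite, mul_zero]
      rw [← Finset.sum_filter]
      refine Finset.sum_congr ?_ fun _ _ => rfl
      ext U
      simp only [Finset.mem_filter, Finset.mem_univ, true_and, Finset.mem_compl,
        Finset.mem_powerset, Finset.subset_iff, Finset.mem_image, not_exists]
      exact ⟨fun h x hx m hm => h m (hm ▸ hx), fun h m hm => h hm m rfl⟩
    have h4 := congrArg (Int.cast : ℤ → R)
      (Finset.sum_powerset_neg_one_pow_card (x := (Finset.univ.image φ)ᶜ))
    push_cast at h4
    rw [h3, h4]
    have h5 : (Finset.univ.image φ)ᶜ = ∅ ↔ Function.Bijective φ := by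
      rw [Finset.compl_eq_empty_iff, Finset.eq_univ_iff_forall,
        ← Finite.surjective_iff_bijective]
      simp [Function.Surjective]
    by_cases hφ : Function.Bijective φ
    · rw [if_pos (h5.2 hφ), if_pos hφ, one_mul]
    · rw [if_neg (mt h5.1 hφ), if_neg hφ, zero_mul]
  simp only [h1, Finset.mul_sum]
  rw [Finset.sum_comm]
  simp only [h2]
  rw [← Finset.sum_filter]
  refine Finset.sum_bij' (fun σ _ => ⇑σ)
    (fun φ hφ => Equiv.ofBijective φ (Finset.mem_filter.1 hφ).2) ?_ ?_ ?_ ?_ ?_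
  · exact fun σ _ => Finset.mem_filter.2 ⟨Finset.mem_univ _, σ.bijective⟩
  · simp
  · exact fun σ _ => Equiv.ext fun _ => rfl
  · exact fun _ _ => rfl
  · exact fun _ _ => rfl

/-- Polarization: a symmetrized tensor product is a combination of pure powers. -/
theorem sum_perm_tensor (q : Fin k → smoothCompact d) :
    ∑ σ : Equiv.Perm (Fin k), tensor (q ∘ σ) =
      ∑ U : Finset (Fin k), (-1 : ℂ) ^ U.card • tensor fun _ => ∑ i ∈ Uᶜ, q i := by
  ext x
  rw [sum_apply, sum_apply]
  simp only [smul_apply, tensor_apply, smul_eq_mul, Submodule.coe_sum, Finset.sum_apply,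
    Function.comp_apply]
  exact sum_perm_prod_eq fun i m => (q i).1 (x m)

/-- A bosonic Schwartz function which is orthogonal to all pure powers vanishes. -/
theorem eq_zero_of_ip_pow {f : Bosonic d k}
    (h : ∀ p : smoothCompact d, ip (tensor fun _ => p) f.1 = 0) : f = 0 := by
  refine Subtype.ext (eq_zero_of_ip_tensor fun q => ?_)
  have h1 : ip (∑ σ : Equiv.Perm (Fin k), tensor (q ∘ σ)) f.1 = 0 := by
    rw [sum_perm_tensor, ip_sum_left]
    exact Finset.sum_eq_zero fun U _ => by rw [ip_smul_left, h, mul_zero]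
  have h2 (σ : Equiv.Perm (Fin k)) : ip (tensor (q ∘ σ)) f.1 = ip (tensor q) f.1 := by
    have := permute_tensor σ⁻¹ q
    rw [inv_inv] at this
    change ip (tensor fun n => q (σ n)) f.1 = _
    rw [← this, ip_permute_left, mem_bosonic_iff.1 f.2]
  rw [ip_sum_left, Finset.sum_congr rfl fun σ _ => h2 σ, Finset.sum_const, Finset.card_univ,
    Fintype.card_perm, Fintype.card_fin] at h1
  exact (smul_eq_zero_iff_right k.factorial_ne_zero).1 h1

theorem tensor_const_mem (p : smoothCompact d) : tensor (fun _ : Fin N => p) ∈ bosonic d N :=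
  mem_bosonic_iff.2 fun σ => permute_tensor σ _

end Tensor

/-! ### The embedding into N-particle observables and its injectivity -/

section Embedding

variable {d k l N : ℕ}

/-- If two embeddings hit all indices at which `x` differs from `b`, then the two restrictions of
`x` agree up to a permutation. -/
theorem exists_perm_comp_eq {α β γ : Type*} [Finite α] {x : β → γ} {b : γ} (i j : α ↪ β)
    (hi : ∀ n, x n ≠ b → n ∈ Set.range i) (hj : ∀ n, x n ≠ b → n ∈ Set.range j) :
    ∃ σ : Equiv.Perm α, x ∘ j = (x ∘ i) ∘ σ := by
  classical
  have := Fintype.ofFinite α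
  have hbij (e : α ↪ β) (he : ∀ n, x n ≠ b → n ∈ Set.range e) : Function.Bijective
      (fun m : {m // x (e m) ≠ b} => (⟨e m.1, m.2⟩ : {n // x n ≠ b})) := by
    refine ⟨fun m m' h => Subtype.ext (e.injective (congrArg Subtype.val h)), ?_⟩
    rintro ⟨n, hn⟩
    obtain ⟨m, rfl⟩ := he n hn
    exact ⟨⟨m, hn⟩, rfl⟩
  let E := (Equiv.ofBijective _ (hbij j hj)).trans (Equiv.ofBijective _ (hbij i hi)).symm
  refine ⟨E.extendSubtype, funext fun m => ?_⟩
  by_cases hm : x (j m) ≠ b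
  · have h1 : i (E ⟨m, hm⟩).1 = j m := congrArg Subtype.val
      ((Equiv.ofBijective _ (hbij i hi)).apply_symm_apply ⟨j m, hm⟩)
    rw [Function.comp_apply, Function.comp_apply, Function.comp_apply,
      E.extendSubtype_apply_of_mem m hm, h1]
  · have := E.extendSubtype_not_mem m hm
    rw [Function.comp_apply, Function.comp_apply, Function.comp_apply, not_ne_iff.1 hm,
      not_ne_iff.1 this]

/-- Symmetric multiplication by a power of a nonzero function is injective. -/
theorem eq_zero_of_sum_mul_prod_eq_zero {E R : Type*} [CommRing R] [IsDomain R] [CharZero R]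
    (hkN : k ≤ N) {p : E → R} {b : E} (hb : p b ≠ 0) {h : (Fin k → E) → R}
    (hsymm : ∀ (σ : Equiv.Perm (Fin k)) x, h (x ∘ σ) = h x)
    (hsum : ∀ x : Fin N → E, ∑ j : Fin k ↪ Fin N,
      (∏ n ∈ (Finset.univ.map j)ᶜ, p (x n)) * h (x ∘ j) = 0) (a : Fin k → E) : h a = 0 := by
  classical
  -- Induction on the number of entries of a that differ from b. The equation is evaluated at x,
  -- which is a completed by copies of b. A tuple missing some entry of x other than b sees fewer
  -- such entries, so its term vanishes by induction; every other tuple contributes the same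
  -- multiple of h a.
  induction hr : (Finset.univ.filter fun i => a i ≠ b).card using Nat.strong_induction_on
    generalizing a with
  | _ r ih =>
  let c : Fin k ↪ Fin N := (Fin.castLEEmb hkN)
  let x : Fin N → E := Function.extend c a fun _ => b
  have hxc : x ∘ c = a := funext fun i => c.injective.extend_apply a (fun _ => b) i
  have hx (n : Fin N) (hn : x n ≠ b) : n ∈ Set.range c := by
    by_contra hc
    exact hn (Function.extend_apply' _ _ _ hc)
  let X := Finset.univ.filter fun n => x n ≠ b
  have hX (e : Fin k ↪ Fin N) : (Finset.univ.filter fun i => x (e i) ≠ b).map e ⊆ X := by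
    intro n hn
    simp only [Finset.mem_map, Finset.mem_filter, Finset.mem_univ, true_and] at hn
    obtain ⟨i, hi, rfl⟩ := hn
    simpa [X] using hi
  have hXcard : X.card = r := by
    rw [← hr, ← hxc, ← Finset.card_map c]
    refine congrArg _ (Finset.Subset.antisymm (fun n hn => ?_) (hX c))
    have hn' : x n ≠ b := (Finset.mem_filter.1 hn).2
    obtain ⟨i, rfl⟩ := hx n hn'
    exact Finset.mem_map_of_mem c (Finset.mem_filter.2 ⟨Finset.mem_univ _, hn'⟩)
  have hterm (j : Fin k ↪ Fin N) : (∏ n ∈ (Finset.univ.map j)ᶜ, p (x n)) * h (x ∘ j) =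
      if ∀ n, x n ≠ b → n ∈ Set.range j then p b ^ (N - k) * h a else 0 := by
    split_ifs with hj
    · obtain ⟨σ, hσ⟩ := exists_perm_comp_eq c j hx hj
      rw [hσ, hsymm, hxc]
      congr 1
      rw [Finset.prod_congr rfl (g := fun _ => p b), Finset.prod_const, Finset.card_compl,
        Finset.card_map, Finset.card_univ, Fintype.card_fin, Fintype.card_fin]
      intro n hn
      by_contra hne
      have : n ∈ Set.range j := hj n fun h => hne (congrArg p h)
      simp only [Finset.mem_compl, Finset.mem_map, Finset.mem_univ, true_and] at hn
      exact hn this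
    · push Not at hj
      obtain ⟨n, hn, hnj⟩ := hj
      rw [ih _ ?_ (x ∘ j) rfl, mul_zero]
      rw [← hXcard, ← Finset.card_map j]
      refine Finset.card_lt_card ⟨hX j, fun hsub => hnj ?_⟩
      have := hsub (Finset.mem_filter.2 ⟨Finset.mem_univ n, hn⟩)
      obtain ⟨i, -, hi⟩ := Finset.mem_map.1 this
      exact ⟨i, hi⟩
  have h0 := hsum x
  simp only [hterm] at h0
  rw [← Finset.sum_filter, Finset.sum_const, nsmul_eq_mul, mul_eq_zero, mul_eq_zero] at h0
  rcases h0 with h0 | h0 | h0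
  -- The number of contributing tuples is not zero, since c is one of them.
  · rw [Nat.cast_eq_zero, Finset.card_eq_zero] at h0
    have : c ∈ Finset.univ.filter fun j : Fin k ↪ Fin N => ∀ n, x n ≠ b → n ∈ Set.range j :=
      Finset.mem_filter.2 ⟨Finset.mem_univ _, hx⟩
    rw [h0] at this
    simp at this
  · exact absurd h0 (pow_ne_zero _ hb)
  · exact h0

/-- The sum of all the extensions of an operator to `N` particles. -/
def sumLift (N : ℕ) (T : Test d k →L[ℂ] Test d k) : Test d N →L[ℂ] Test d N :=
  ∑ j : Fin k ↪ Fin N, lift j T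

theorem sumLift_apply (T : Test d k →L[ℂ] Test d k) (F : Test d N) :
    sumLift N T F = ∑ j : Fin k ↪ Fin N, lift j T F := sum_apply ..

/-- A permutation of the variables merely relabels the tuples, so the full sum commutes with it, and
hence preserves symmetry, although a single lift may not. -/
theorem permute_sumLift (σ : Equiv.Perm (Fin N)) (T : Test d k →L[ℂ] Test d k)
    (F : Test d N) : permute σ (sumLift N T F) = sumLift N T (permute σ F) := by
  rw [sumLift_apply, sumLift_apply, map_sum]
  simp only [lift_permute]
  symm
  refine Fintype.sum_equiv ((Equiv.refl _).embeddingCongr σ⁻¹) _ _ fun j => ?_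
  congr 2

theorem sumLift_mem_bosonic (T : Test d k →L[ℂ] Test d k) (f : Bosonic d N) :
    sumLift N T f.1 ∈ bosonic d N :=
  mem_bosonic_iff.2 fun σ => by rw [permute_sumLift, mem_bosonic_iff.1 f.2]

theorem IsSkew.sumLift {T : Test d k →L[ℂ] Test d k} (hT : IsSkew T) : IsSkew (sumLift N T) :=
  IsSkew.sum _ fun j _ => hT.lift j

theorem Observable.ext_mem (A : Observable d k) (F : Test d k) : A.ext F ∈ bosonic d k :=
  (A.op (symmetrize d k F)).2

/-- On a pure power the sum is a symmetrized product of h = A(p⊗...⊗p) with powers of p, and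
cancelling p gives h = 0. Skewness then makes every A f orthogonal to all pure powers. -/
theorem Observable.eq_zero_of_sumLift (hk : 1 ≤ k) (hkN : k ≤ N) (A : Observable d k)
    (h : ∀ f : Bosonic d N, sumLift N A.ext f.1 = 0) : A = 0 := by
  have hpow (p : smoothCompact d) : A.ext (tensor fun _ => p) = 0 := by
    by_cases hp : ∃ b, p.1 b ≠ 0
    · obtain ⟨b, hb⟩ := hp
      ext a
      refine eq_zero_of_sum_mul_prod_eq_zero hkN hb (A.ext_mem _) (fun x => ?_) a
      have := DFunLike.congr_fun (h ⟨_, tensor_const_mem p⟩) x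
      rw [sumLift_apply, sum_apply, zero_apply] at this
      simp only [lift_tensor] at this
      exact this
    -- For p = 0 the pure power is itself zero because k ≥ 1.
    · push Not at hp
      have : tensor (fun _ : Fin k => p) = 0 := by
        ext x
        rw [tensor_apply, zero_apply]
        exact Finset.prod_eq_zero (Finset.mem_univ (⟨0, hk⟩ : Fin k)) (hp _)
      rw [this, map_zero]
  refine Observable.ext_of_op fun f x => ?_
  have : A.op f = 0 := eq_zero_of_ip_pow fun p => by
    rw [← A.ext_coe, ← neg_neg (ip _ _), ← A.isSkew_ext, hpow]
    simp [ip]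
  rw [this]
  rfl

/-- The normalization constant of the embedding. -/
def normConst (k N : ℕ) : ℝ := ((k.factorial * N.choose k : ℕ) : ℝ)⁻¹

theorem normConst_ne_zero (hkN : k ≤ N) : normConst k N ≠ 0 :=
  inv_ne_zero (Nat.cast_ne_zero.2 (mul_ne_zero k.factorial_ne_zero
    (Nat.choose_pos hkN).ne'))

theorem isEmbedded_iff (A : Observable d k) (E : Observable d N) : IsEmbedded A E ↔
    ∀ f : Bosonic d N, (E.op f).1 = (normConst k N : ℂ) • sumLift N A.ext f.1 := by
  have e (f : Bosonic d N) (x : Config d N) : ((k.factorial * N.choose k : ℕ) : ℂ)⁻¹ *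
      ∑ j : Fin k ↪ Fin N, extension A j f x =
        ((normConst k N : ℂ) • sumLift N A.ext f.1) x := by
    rw [smul_apply, sumLift_apply, sum_apply, smul_eq_mul, normConst]
    simp only [extension_eq_lift]
    push_cast
    rfl
  exact ⟨fun h f => SchwartzMap.ext fun x => (h f x).trans (e f x),
    fun h f x => (DFunLike.congr_fun (h f) x).trans (e f x).symm⟩

theorem isEmbedded_embed (A : Observable d k) : IsEmbedded A (embed N A) := by
  have h : ∃ E : Observable d N, IsEmbedded A E := by
    have hs : IsSkew ((normConst k N : ℂ) • sumLift N A.ext) :=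
      A.isSkew_ext.sumLift.real_smul _
    refine ⟨Observable.ofSkew _ hs, (isEmbedded_iff _ _).2 fun f => ?_⟩
    refine Observable.ofSkew_op_val hs f ?_
    exact (bosonic d N).smul_mem _ (sumLift_mem_bosonic _ f)
  rw [embed, dif_pos h]
  exact h.choose_spec

theorem embed_op (A : Observable d k) (f : Bosonic d N) :
    ((embed N A).op f).1 = (normConst k N : ℂ) • sumLift N A.ext f.1 :=
  (isEmbedded_iff _ _).1 (isEmbedded_embed A) f

theorem Observable.op_add (A B : Observable d k) (f : Bosonic d k) :
    (A + B).op f = A.op f + B.op f := rfl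

theorem Observable.op_smul (c : ℝ) (A : Observable d k) (f : Bosonic d k) :
    (c • A).op f = c • A.op f := rfl

theorem Observable.ext_add (A B : Observable d k) : (A + B).ext = A.ext + B.ext := rfl

theorem Observable.ext_smul (c : ℝ) (A : Observable d k) : (c • A).ext = (c : ℂ) • A.ext := rfl

theorem embed_add (A B : Observable d k) : embed N (A + B) = embed N A + embed N B := by
  refine Observable.ext_of_op fun f x => ?_
  rw [embed_op, Observable.op_add, Submodule.coe_add, embed_op, embed_op, ← smul_add]
  congr 2
  simp only [sumLift_apply, Observable.ext_add, lift_add, add_apply, Finset.sum_add_distrib]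

theorem embed_smul (c : ℝ) (A : Observable d k) : embed N (c • A) = c • embed N A := by
  refine Observable.ext_of_op fun f x => ?_
  have h : ((c • embed N A).op f).1 = (c : ℂ) • ((embed N A).op f).1 := rfl
  rw [h, embed_op, embed_op, smul_comm]
  congr 2
  simp only [sumLift_apply, Observable.ext_smul, lift_smul, smul_apply, Finset.smul_sum]

/-- The embedding as a linear map. -/
def embedL (d k N : ℕ) : Observable d k →ₗ[ℝ] Observable d N where
  toFun := embed N
  map_add' := embed_add
  map_smul' := embed_smul

/-- The normalization is nonzero for k ≤ N, so a zero image means that the unnormalized sum of lifts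
vanishes on bosonic functions. -/
theorem embed_injective (hk : 1 ≤ k) (hkN : k ≤ N) :
    Function.Injective (embed N : Observable d k → Observable d N) := by
  refine (injective_iff_map_eq_zero (embedL d k N)).2 fun A hA => ?_
  refine A.eq_zero_of_sumLift hk hkN fun f => ?_
  have h : ((embed N A).op f).1 = 0 := by
    change ((embedL d k N A).op f).1 = 0
    rw [hA]
    rfl
  rw [embed_op, smul_eq_zero] at h
  exact h.resolve_left (Complex.ofReal_ne_zero.2 (normConst_ne_zero hkN))

end Embedding

/-! ### Commutators of embedded observables -/

section Commutator

/-! ### Counting the factorizations of a pair of tuples through m particles -/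

section Counting

variable {l j m N : ℕ}

/-- The pair of embeddings obtained by composing a pair of embeddings with another one. -/
def compPair (t : (Fin m ↪ Fin N) × (Fin l ↪ Fin m) × (Fin j ↪ Fin m)) :
    (Fin l ↪ Fin N) × (Fin j ↪ Fin N) :=
  (t.2.1.trans t.1, t.2.2.trans t.1)

open Classical in
/-- The number of factorizations of a pair of embeddings through `Fin m`. -/
def factorCount (m : ℕ) (p : (Fin l ↪ Fin N) × (Fin j ↪ Fin N)) : ℕ :=
  (Finset.univ.filter fun t : (Fin m ↪ Fin N) × (Fin l ↪ Fin m) × (Fin j ↪ Fin m) =>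
    compPair t = p).card

/-- Composing the outer embedding with π is a bijection between the two sets of factorizations. -/
theorem factorCount_perm (π : Equiv.Perm (Fin N)) (p : (Fin l ↪ Fin N) × (Fin j ↪ Fin N)) :
    factorCount m (p.1.trans π.toEmbedding, p.2.trans π.toEmbedding) = factorCount m p := by
  classical
  have hinj {n : ℕ} {a b : Fin n ↪ Fin N} (h : a.trans π.toEmbedding = b.trans π.toEmbedding) :
      a = b :=
    Function.Embedding.ext fun x => π.injective (DFunLike.congr_fun h x)
  symm
  refine Finset.card_bij (fun t _ => (t.1.trans π.toEmbedding, t.2)) ?_ ?_ ?_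
  · intro t ht
    rw [Finset.mem_filter] at ht ⊢
    refine ⟨Finset.mem_univ _, ?_⟩
    rw [← ht.2]
    rfl
  · rintro ⟨e, t⟩ _ ⟨e', t'⟩ _ h
    obtain ⟨h1, h2⟩ := Prod.ext_iff.1 h
    exact Prod.ext (hinj h1) h2
  · rintro ⟨e, t⟩ ht
    have he : (e.trans π.symm.toEmbedding).trans π.toEmbedding = e :=
      Function.Embedding.ext fun x => π.apply_symm_apply _
    refine ⟨(e.trans π.symm.toEmbedding, t), ?_, Prod.ext he rfl⟩
    rw [Finset.mem_filter] at ht ⊢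
    refine ⟨Finset.mem_univ _, ?_⟩
    obtain ⟨h1, h2⟩ := Prod.ext_iff.1 ht.2
    refine Prod.ext (hinj (Eq.trans ?_ h1)) (hinj (Eq.trans ?_ h2))
    · change t.1.trans ((e.trans π.symm.toEmbedding).trans π.toEmbedding) = _
      rw [he]
      rfl
    · change t.2.trans ((e.trans π.symm.toEmbedding).trans π.toEmbedding) = _
      rw [he]
      rfl

theorem exists_perm_trans_eq (e e' : Fin m ↪ Fin N) :
    ∃ π : Equiv.Perm (Fin N), e.trans π.toEmbedding = e' := by
  classical
  let E : {n // n ∈ Set.range e} ≃ {n // n ∈ Set.range e'} :=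
    (Equiv.ofInjective e e.injective).symm.trans (Equiv.ofInjective e' e'.injective)
  refine ⟨E.extendSubtype, Function.Embedding.ext fun i => ?_⟩
  have h1 := E.extendSubtype_apply_of_mem (e i) ⟨i, rfl⟩
  have h2 : (Equiv.ofInjective e e.injective).symm ⟨e i, i, rfl⟩ = i :=
    Equiv.ofInjective_symm_apply e.injective i
  change E.extendSubtype (e i) = e' i
  rw [h1]
  change (Equiv.ofInjective e' e'.injective
    ((Equiv.ofInjective e e.injective).symm ⟨e i, i, rfl⟩)).1 = _
  rw [h2]
  rfl

/-- Permutations of `Fin N` act transitively on the embeddings of `Fin m`, so the count depends only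
on the inner pair a. It can therefore serve as a weight on m particles. -/
theorem factorCount_compPair (e e' : Fin m ↪ Fin N) (a : (Fin l ↪ Fin m) × (Fin j ↪ Fin m)) :
    factorCount m (compPair (e, a)) = factorCount m (compPair (e', a)) := by
  obtain ⟨π, rfl⟩ := exists_perm_trans_eq e e'
  exact (factorCount_perm π (compPair (e, a))).symm

theorem factorCount_compPair_pos (t : (Fin m ↪ Fin N) × (Fin l ↪ Fin m) × (Fin j ↪ Fin m)) :
    0 < factorCount m (compPair t) := by
  classical
  exact Finset.card_pos.2 ⟨t, Finset.mem_filter.2 ⟨Finset.mem_univ _, rfl⟩⟩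

/-- The union of the two ranges is enlarged to a set of exactly m indices, possible as m ≤ N; an
enumeration of that set is the outer embedding. -/
theorem factorCount_pos (hmN : m ≤ N) (p : (Fin l ↪ Fin N) × (Fin j ↪ Fin N))
    (hp : (Finset.univ.map p.1 ∪ Finset.univ.map p.2).card ≤ m) : 0 < factorCount m p := by
  classical
  obtain ⟨V, hV, hVm⟩ := Finset.exists_superset_card_eq hp (by simpa using hmN)
  let e : Fin m ↪ Fin N := (V.orderEmbOfFin hVm).toEmbedding
  have he : ∀ n ∈ V, ∃ i, e i = n := fun n hn => by
    have : n ∈ Set.range (V.orderEmbOfFin hVm) := by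
      rw [Finset.range_orderEmbOfFin]
      exact hn
    exact this
  have hfac {r : ℕ} (i : Fin r ↪ Fin N) (hi : Finset.univ.map i ⊆ V) :
      ∃ a : Fin r ↪ Fin m, a.trans e = i := by
    choose a ha using fun x => he (i x) (hi (Finset.mem_map_of_mem i (Finset.mem_univ x)))
    refine ⟨⟨a, fun x y h => i.injective ?_⟩, Function.Embedding.ext ha⟩
    rw [← ha, ← ha, h]
  obtain ⟨a, ha⟩ := hfac p.1 (Finset.subset_union_left.trans hV)
  obtain ⟨b, hb⟩ := hfac p.2 (Finset.subset_union_right.trans hV)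
  have : compPair (e, a, b) = p := Prod.ext ha hb
  rw [← this]
  exact factorCount_compPair_pos _

/-- The total number of factorizations of the images in `Fin N` of a pair of embeddings. -/
def totalCount (N : ℕ) (a : (Fin l ↪ Fin m) × (Fin j ↪ Fin m)) : ℕ :=
  ∑ e : Fin m ↪ Fin N, factorCount m (compPair (e, a))

theorem totalCount_eq (e : Fin m ↪ Fin N) (a : (Fin l ↪ Fin m) × (Fin j ↪ Fin m)) :
    totalCount N a = Fintype.card (Fin m ↪ Fin N) * factorCount m (compPair (e, a)) := by
  rw [totalCount, Finset.sum_congr rfl fun e' _ => factorCount_compPair e' e a, Finset.sum_const,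
    Finset.card_univ, smul_eq_mul]

theorem totalCount_perm (σ : Equiv.Perm (Fin m)) (a : (Fin l ↪ Fin m) × (Fin j ↪ Fin m)) :
    totalCount N (a.1.trans σ.toEmbedding, a.2.trans σ.toEmbedding) = totalCount N a := by
  refine Fintype.sum_equiv (σ.symm.embeddingCongr (Equiv.refl _)) _ _ fun e => ?_
  congr 1

/-- A pair p is reached `factorCount m p` times, each time with weight 1 / (card · `factorCount m
p`), so it counts with weight 1 / card. Pairs that are never reached have K p = 0. -/
theorem sum_compPair {V : Type*} [AddCommGroup V] [Module ℝ V]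
    (K : (Fin l ↪ Fin N) × (Fin j ↪ Fin N) → V) (hK : ∀ p, factorCount m p = 0 → K p = 0) :
    ∑ t : (Fin m ↪ Fin N) × (Fin l ↪ Fin m) × (Fin j ↪ Fin m),
      (totalCount N t.2 : ℝ)⁻¹ • K (compPair t) =
        (Fintype.card (Fin m ↪ Fin N) : ℝ)⁻¹ • ∑ p, K p := by
  classical
  rw [← Finset.sum_fiberwise (g := compPair), Finset.smul_sum]
  refine Finset.sum_congr rfl fun p _ => ?_
  rw [Finset.sum_congr rfl (g := fun _ =>
    ((Fintype.card (Fin m ↪ Fin N) : ℝ)⁻¹ * (factorCount m p : ℝ)⁻¹) • K p)]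
  · rw [Finset.sum_const, ← Nat.cast_smul_eq_nsmul ℝ, smul_smul]
    by_cases hp : factorCount m p = 0
    · rw [hK p hp, smul_zero, smul_zero]
    · congr 1
      change (factorCount m p : ℝ) * _ = _
      have : (factorCount m p : ℝ) ≠ 0 := Nat.cast_ne_zero.2 hp
      rw [mul_left_comm, mul_inv_cancel₀ this, mul_one]
  · intro t ht
    have ht' : compPair t = p := (Finset.mem_filter.1 ht).2
    have : totalCount N t.2 = _ := totalCount_eq t.1 t.2
    rw [this, ht', Nat.cast_mul, mul_inv]

end Counting

variable {d l j m N : ℕ}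

/-- The commutator of two operators acting on some of the variables. -/
def liftComm (S : Test d l →L[ℂ] Test d l) (T : Test d j →L[ℂ] Test d j)
    (p : (Fin l ↪ Fin N) × (Fin j ↪ Fin N)) : Test d N →L[ℂ] Test d N :=
  lift p.1 S ∘L lift p.2 T - lift p.2 T ∘L lift p.1 S

theorem liftComm_apply (S : Test d l →L[ℂ] Test d l) (T : Test d j →L[ℂ] Test d j)
    (p : (Fin l ↪ Fin N) × (Fin j ↪ Fin N)) (F : Test d N) : liftComm S T p F =
      lift p.1 S (lift p.2 T F) - lift p.2 T (lift p.1 S F) := rfl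

theorem lift_liftComm (S : Test d l →L[ℂ] Test d l) (T : Test d j →L[ℂ] Test d j)
    (t : (Fin m ↪ Fin N) × (Fin l ↪ Fin m) × (Fin j ↪ Fin m)) :
    lift t.1 (liftComm S T t.2) = liftComm S T (compPair t) := by
  rw [liftComm, lift_sub, lift_comp, lift_comp, lift_lift, lift_lift]
  rfl

theorem liftComm_permute (S : Test d l →L[ℂ] Test d l) (T : Test d j →L[ℂ] Test d j)
    (p : (Fin l ↪ Fin N) × (Fin j ↪ Fin N)) (σ : Equiv.Perm (Fin N)) (F : Test d N) :
    liftComm S T p (permute σ F) = permute σ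
      (liftComm S T (p.1.trans σ⁻¹.toEmbedding, p.2.trans σ⁻¹.toEmbedding) F) := by
  rw [liftComm_apply, liftComm_apply, lift_permute, lift_permute, lift_permute, lift_permute,
    map_sub]

/-- Two overlapping ranges have a union of at most min(l + j - 1, N) ≤ m indices and thus factor. A
pair without factorization is therefore disjoint, and its lifts commute. -/
theorem liftComm_eq_zero {S : Test d l →L[ℂ] Test d l} {T : Test d j →L[ℂ] Test d j}
    (hS : IsSkew S) (hT : IsSkew T) (hmN : m ≤ N) (hm : min (l + j - 1) N ≤ m)
    (p : (Fin l ↪ Fin N) × (Fin j ↪ Fin N)) (hp : factorCount m p = 0) :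
    liftComm S T p = 0 := by
  rw [liftComm, sub_eq_zero]
  refine lift_comp_comm ?_ hS hT
  by_contra hd
  refine (factorCount_pos hmN p ?_).ne' hp
  have h1 := Finset.card_union_add_card_inter (Finset.univ.map p.1) (Finset.univ.map p.2)
  have h2 : 0 < (Finset.univ.map p.1 ∩ Finset.univ.map p.2).card :=
    Finset.card_pos.2 (Finset.not_disjoint_iff_nonempty_inter.1 hd)
  have h3 := Finset.card_le_univ (Finset.univ.map p.1 ∪ Finset.univ.map p.2)
  simp only [Finset.card_map, Finset.card_univ, Fintype.card_fin] at h1 h3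
  omega

/-- A weighted sum of commutators on `m` particles. -/
def commOp (m N : ℕ) (S : Test d l →L[ℂ] Test d l) (T : Test d j →L[ℂ] Test d j) :
    Test d m →L[ℂ] Test d m :=
  ∑ a : (Fin l ↪ Fin m) × (Fin j ↪ Fin m), (totalCount N a : ℝ)⁻¹ • liftComm S T a

theorem commOp_apply (S : Test d l →L[ℂ] Test d l) (T : Test d j →L[ℂ] Test d j)
    (F : Test d m) : commOp m N S T F = ∑ a : (Fin l ↪ Fin m) × (Fin j ↪ Fin m),
      (totalCount N a : ℝ)⁻¹ • liftComm S T a F := by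
  rw [commOp, sum_apply]
  rfl

theorem IsSkew.commOp {S : Test d l →L[ℂ] Test d l} {T : Test d j →L[ℂ] Test d j}
    (hS : IsSkew S) (hT : IsSkew T) : IsSkew (commOp m N S T) :=
  IsSkew.sum _ fun a _ => ((hS.lift a.1).commutator (hT.lift a.2)).real_smul _

theorem permute_commOp (σ : Equiv.Perm (Fin m)) (S : Test d l →L[ℂ] Test d l)
    (T : Test d j →L[ℂ] Test d j) (F : Test d m) :
    permute σ (commOp m N S T F) = commOp m N S T (permute σ F) := by
  rw [commOp_apply, commOp_apply, map_sum]
  simp only [liftComm_permute]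
  symm
  refine Fintype.sum_equiv (((Equiv.refl _).embeddingCongr σ⁻¹).prodCongr
    ((Equiv.refl _).embeddingCongr σ⁻¹)) _ _ fun a => ?_
  rw [← (permute σ).map_smul_of_tower, ← totalCount_perm σ⁻¹ a]
  rfl

/-- The preimage under the embedding of the commutator of two embedded observables. -/
def commObs (m N : ℕ) (A : Observable d l) (B : Observable d j) : Observable d m :=
  -- N comes from the bracket of 𝔤_N and the next two factors from the embeddings of A and B. The
  -- cardinality cancels the one in `sum_compPair`, and the last factor cancels the normalization of
  -- the embedding of the result.
  (N * normConst l N * normConst j N * Fintype.card (Fin m ↪ Fin N) * (normConst m N)⁻¹ : ℝ) •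
    Observable.ofSkew (commOp m N A.ext B.ext) (A.isSkew_ext.commOp B.isSkew_ext)

/-- `totalCount` is permutation invariant, so the weighted sum preserves bosonic functions and the
symmetrization in `ofSkew` does nothing. -/
theorem commObs_op (A : Observable d l) (B : Observable d j) (f : Bosonic d m) :
    ((commObs m N A B).op f).1 =
      (N * normConst l N * normConst j N * Fintype.card (Fin m ↪ Fin N) * (normConst m N)⁻¹ : ℝ) •
        commOp m N A.ext B.ext f.1 := by
  have h : commOp m N A.ext B.ext f.1 ∈ bosonic d m :=
    mem_bosonic_iff.2 fun σ => by rw [permute_commOp, mem_bosonic_iff.1 f.2]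
  rw [← Observable.ofSkew_op_val (A.isSkew_ext.commOp B.isSkew_ext) f h]
  rfl

theorem sumLift_commObs (hmN : m ≤ N) (hm : min (l + j - 1) N ≤ m) (A : Observable d l)
    (B : Observable d j) (f : Bosonic d N) : sumLift N (commObs m N A B).ext f.1 =
      (N * normConst l N * normConst j N * (normConst m N)⁻¹ : ℝ) •
        ∑ p, liftComm A.ext B.ext p f.1 := by
  have h1 (e : Fin m ↪ Fin N) : lift e (commObs m N A B).ext f.1 =
      (N * normConst l N * normConst j N * Fintype.card (Fin m ↪ Fin N) * (normConst m N)⁻¹ : ℝ) •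
        ∑ a : (Fin l ↪ Fin m) × (Fin j ↪ Fin m),
          (totalCount N a : ℝ)⁻¹ • liftComm A.ext B.ext (compPair (e, a)) f.1 := by
    have h2 : lift e (commObs m N A B).ext f.1 =
      (N * normConst l N * normConst j N * Fintype.card (Fin m ↪ Fin N) * (normConst m N)⁻¹ : ℝ) •
        lift e (commOp m N A.ext B.ext) f.1 := by
      ext x
      rw [lift_apply, ← slice_val, Observable.ext_coe, commObs_op]
      rfl
    rw [h2, commOp, lift_sum, sum_apply]
    congr 1
    refine Finset.sum_congr rfl fun a _ => ?_
    rw [← lift_liftComm]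
    rfl
  have hM : (Fintype.card (Fin m ↪ Fin N) : ℝ) ≠ 0 := by
    have : Nonempty (Fin m ↪ Fin N) := ⟨Fin.castLEEmb hmN⟩
    exact Nat.cast_ne_zero.2 Fintype.card_ne_zero
  have h3 := sum_compPair (fun p => liftComm A.ext B.ext p f.1) fun p hp => by
    rw [liftComm_eq_zero A.isSkew_ext B.isSkew_ext hmN hm p hp]
    rfl
  rw [Fintype.sum_prod_type] at h3
  rw [sumLift_apply]
  simp only [h1]
  rw [← Finset.smul_sum, h3, smul_smul]
  congr 1
  field_simp

theorem Observable.lie_op (A B : Observable d N) (f : Bosonic d N) : ((A.lie B).op f).1 =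
    (N : ℝ) • ((A.op (B.op f)).1 - (B.op (A.op f)).1) := rfl

theorem embed_op_embed_op (A : Observable d l) (B : Observable d j) (f : Bosonic d N) :
    ((embed N A).op ((embed N B).op f)).1 = (normConst l N * normConst j N) •
      ∑ p : (Fin l ↪ Fin N) × (Fin j ↪ Fin N), lift p.1 A.ext (lift p.2 B.ext f.1) := by
  rw [embed_op, embed_op, map_smul, Complex.coe_smul, Complex.coe_smul, smul_smul]
  congr 1
  rw [sumLift_apply, sumLift_apply, Fintype.sum_prod_type]
  simp only [map_sum]

/-- Both sides are the same multiple of the sum of commutators over all pairs of tuples. The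
hypothesis is only min(l + j - 1, N) ≤ m, as m need only be large enough for overlapping pairs to
factor. -/
theorem lie_embed_embed (hmN : m ≤ N) (hm : min (l + j - 1) N ≤ m) (A : Observable d l)
    (B : Observable d j) :
    Observable.lie (embed N A) (embed N B) = embed N (commObs m N A B) := by
  refine Observable.ext_of_op fun f x => DFunLike.congr_fun ?_ x
  rw [Observable.lie_op, embed_op_embed_op, embed_op_embed_op, embed_op,
    sumLift_commObs hmN hm, Complex.coe_smul, smul_smul]
  have h1 : ∑ p : (Fin j ↪ Fin N) × (Fin l ↪ Fin N), lift p.1 B.ext (lift p.2 A.ext f.1) =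
      ∑ p : (Fin l ↪ Fin N) × (Fin j ↪ Fin N), lift p.2 B.ext (lift p.1 A.ext f.1) :=
    Fintype.sum_equiv (Equiv.prodComm _ _) _ _ fun _ => rfl
  have h2 : normConst m N ≠ 0 := normConst_ne_zero hmN
  rw [h1, mul_comm (normConst j N), ← smul_sub, ← Finset.sum_sub_distrib, smul_smul]
  simp only [liftComm_apply]
  congr 1
  field_simp

end Commutator

/-! ### The topology of the observables, and continuity -/

section Topology

open Bornology Topology

variable {d k l j m N : ℕ}

theorem isVonNBounded_test_iff {S : Set (Test d N)} :
    IsVonNBounded ℂ S ↔ ∀ a b, ∃ r, ∀ F ∈ S, SchwartzMap.seminorm ℝ a b F ≤ r := by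
  rw [(schwartz_withSeminorms ℂ (Config d N) ℂ).isVonNBounded_iff_seminorm_bounded]
  constructor
  · intro h a b
    obtain ⟨r, -, hr⟩ := h (a, b)
    exact ⟨r, fun F hF => (hr F hF).le⟩
  · rintro h ⟨a, b⟩
    obtain ⟨r, hr⟩ := h a b
    exact ⟨max r 0 + 1, by positivity, fun F hF =>
      ((hr F hF).trans (le_max_left _ _)).trans_lt (lt_add_one _)⟩

theorem isVonNBounded_bosonic_iff {S : Set (Bosonic d N)} :
    IsVonNBounded ℂ S ↔ ∀ a b, ∃ r, ∀ f ∈ S, SchwartzMap.seminorm ℝ a b f.1 ≤ r := by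
  have h : WithSeminorms ((schwartzSeminormFamily ℂ (Config d N) ℂ).comp
      (bosonic d N).subtype) :=
    LinearMap.withSeminorms_induced (schwartz_withSeminorms ℂ (Config d N) ℂ) _
  rw [h.isVonNBounded_iff_seminorm_bounded]
  constructor
  · intro h a b
    obtain ⟨r, -, hr⟩ := h (a, b)
    exact ⟨r, fun F hF => (hr F hF).le⟩
  · rintro h ⟨a, b⟩
    obtain ⟨r, hr⟩ := h a b
    exact ⟨max r 0 + 1, by positivity, fun F hF =>
      ((hr F hF).trans (le_max_left _ _)).trans_lt (lt_add_one _)⟩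

/-- Complex conjugation of bosonic Schwartz functions. -/
def conj (f : Bosonic d N) : Bosonic d N :=
  ⟨SchwartzMap.postcompCLM (𝕜 := ℝ) Complex.conjCLE.toContinuousLinearMap f.1, fun σ x => by
    rw [SchwartzMap.postcompCLM_apply, SchwartzMap.postcompCLM_apply, f.2 σ x]⟩

theorem conj_apply (f : Bosonic d N) (x : Config d N) :
    (conj f).1 x = (starRingEnd ℂ) (f.1 x) := rfl

theorem conj_conj (f : Bosonic d N) : conj (conj f) = f :=
  Subtype.ext (SchwartzMap.ext fun x => by rw [conj_apply, conj_apply, Complex.conj_conj])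

theorem isVonNBounded_image_conj {S : Set (Bosonic d N)} (hS : IsVonNBounded ℂ S) :
    IsVonNBounded ℂ (conj '' S) := by
  rw [isVonNBounded_bosonic_iff] at hS ⊢
  intro a b
  obtain ⟨r, hr⟩ := hS a b
  refine ⟨r, ?_⟩
  rintro _ ⟨f, hf, rfl⟩
  refine le_trans ?_ (hr f hf)
  refine SchwartzMap.seminorm_le_bound ℝ a b _ (apply_nonneg _ _) fun x => ?_
  have : ((conj f).1 : Config d N → ℂ) = Complex.conjLIE ∘ f.1 := rfl
  rw [this, LinearIsometryEquiv.norm_iteratedFDeriv_comp_left]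
  exact SchwartzMap.le_seminorm ℝ a b f.1 x

theorem toDual_eq_l2Inner (f g : Bosonic d N) : toDual d N f g = l2Inner (conj g) f := by
  rw [toDual_apply, l2Inner]
  congr 1
  funext x
  rw [conj_apply, Complex.conj_conj, mul_comm]

theorem l2Inner_eq_toDual (f g : Bosonic d N) : l2Inner g f = toDual d N f (conj g) := by
  rw [toDual_eq_l2Inner, conj_conj]

theorem toDual_injective : Function.Injective (toDual d N) := by
  refine (injective_iff_map_eq_zero (toDual d N)).2 fun f hf => ?_
  refine Subtype.ext (eq_zero_of_ip_self ?_)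
  rw [← l2Inner_eq_ip, l2Inner_eq_toDual, hf]
  rfl

/-- The linear map which induces the topology of the space of observables. -/
def Observable.toCLM (d k : ℕ) : Observable d k →ₗ[ℝ] (Bosonic d k →L[ℂ] BosonicDual d k) where
  toFun A := (toDual d k).comp A.op
  map_add' A B := ContinuousLinearMap.comp_add _ _ _
  map_smul' c A := by
    ext f g
    change toDual d k (c • A.op f) g = c • toDual d k (A.op f) g
    rw [(toDual d k).map_smul_of_tower]
    rfl

theorem Observable.toCLM_injective : Function.Injective (Observable.toCLM d k) := fun A B h =>
  Observable.ext_of_op fun f x => by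
    have : A.op f = B.op f := toDual_injective (DFunLike.congr_fun h f)
    rw [this]

theorem Observable.isInducing_toCLM : IsInducing (Observable.toCLM d k) := ⟨rfl⟩

instance : IsTopologicalAddGroup (Observable d k) :=
  topologicalAddGroup_induced (Observable.toCLM d k)

instance : ContinuousSMul ℝ (Bosonic d k →L[ℂ] BosonicDual d k) :=
  IsScalarTower.continuousSMul (M := ℝ) ℂ

instance : ContinuousSMul ℝ (Observable d k) :=
  continuousSMul_induced (Observable.toCLM d k)

instance : LocallyConvexSpace ℝ (Observable d k) :=
  LocallyConvexSpace.induced (Observable.toCLM d k)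

instance : T2Space (Observable d k) :=
  T2Space.of_injective_continuous Observable.toCLM_injective
    Observable.isInducing_toCLM.continuous

/-- Bounded convergence is unfolded twice, once for the operators and once for the strong dual.
Conjugation, which preserves bounded sets, turns the bilinear pairing into the inner product. -/
theorem Observable.hasBasis_nhds_zero : (𝓝 (0 : Observable d k)).HasBasis
    (fun t : Set (Bosonic d k) × (Set (Bosonic d k) × ℝ) =>
      IsVonNBounded ℂ t.1 ∧ IsVonNBounded ℂ t.2.1 ∧ 0 < t.2.2)
    (fun t => {A | ∀ u ∈ t.1, ∀ v ∈ t.2.1, ‖l2Inner v (A.op u)‖ ≤ t.2.2}) := by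
  have h1 := ContinuousLinearMap.hasBasis_nhds_zero_of_basis (σ := RingHom.id ℂ)
    (E := Bosonic d k) (ContinuousLinearMap.hasBasis_nhds_zero_of_basis (σ := RingHom.id ℂ)
      (E := Bosonic d k) (Metric.nhds_basis_closedBall (x := (0 : ℂ))))
  have h2 := h1.comap (Observable.toCLM d k)
  rw [← map_zero (Observable.toCLM d k), ← Observable.isInducing_toCLM.nhds_eq_comap] at h2
  refine h2.to_hasBasis ?_ ?_
  · rintro ⟨S, S', δ⟩ ⟨hS, hS', hδ⟩
    refine ⟨⟨S, conj '' S', δ⟩, ⟨hS, isVonNBounded_image_conj hS', hδ⟩, ?_⟩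
    intro A hA u hu v hv
    rw [mem_closedBall_zero_iff]
    have := hA u hu (conj v) ⟨v, hv, rfl⟩
    rwa [← toDual_eq_l2Inner] at this
  · rintro ⟨S, S', δ⟩ ⟨hS, hS', hδ⟩
    refine ⟨⟨S, conj '' S', δ⟩, ⟨hS, isVonNBounded_image_conj hS', hδ⟩, ?_⟩
    intro A hA u hu v hv
    have := hA u hu (conj v) ⟨v, hv, rfl⟩
    rw [mem_closedBall_zero_iff] at this
    rwa [l2Inner_eq_toDual]

/-- A family of functionals of observables is controlled if it is uniformly bounded by a
continuous seminorm on the space of observables. -/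
def IsControlled {ι : Type*} (Φ : Observable d k → ι → ℂ) : Prop :=
  ∃ (C C' : Set (Bosonic d k)) (M : ℝ), IsVonNBounded ℂ C ∧ IsVonNBounded ℂ C' ∧ 0 ≤ M ∧
    ∀ (A : Observable d k) (δ : ℝ), 0 ≤ δ → (∀ u ∈ C, ∀ v ∈ C', ‖l2Inner v (A.op u)‖ ≤ δ) →
      ∀ i, ‖Φ A i‖ ≤ M * δ

namespace IsControlled

variable {ι : Type*} {Φ Ψ : Observable d k → ι → ℂ}

theorem zero : IsControlled (0 : Observable d k → ι → ℂ) :=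
  ⟨∅, ∅, 0, isVonNBounded_empty _ _, isVonNBounded_empty _ _, le_rfl, fun A δ _ _ i => by simp⟩

theorem add (hΦ : IsControlled Φ) (hΨ : IsControlled Ψ) : IsControlled (Φ + Ψ) := by
  obtain ⟨C, C', M, hC, hC', hM, h⟩ := hΦ
  obtain ⟨D, D', M', hD, hD', hM', h'⟩ := hΨ
  refine ⟨C ∪ D, C' ∪ D', M + M', hC.union hD, hC'.union hD', by positivity,
    fun A δ hδ hA i => ?_⟩
  rw [add_mul]
  exact (norm_add_le _ _).trans (add_le_add
    (h A δ hδ (fun u hu v hv => hA u (Or.inl hu) v (Or.inl hv)) i)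
    (h' A δ hδ (fun u hu v hv => hA u (Or.inr hu) v (Or.inr hv)) i))

theorem const_mul (hΦ : IsControlled Φ) (c : ℂ) : IsControlled fun A i => c * Φ A i := by
  obtain ⟨C, C', M, hC, hC', hM, h⟩ := hΦ
  refine ⟨C, C', ‖c‖ * M, hC, hC', by positivity, fun A δ hδ hA i => ?_⟩
  rw [norm_mul, mul_assoc]
  exact mul_le_mul_of_nonneg_left (h A δ hδ hA i) (norm_nonneg _)

theorem sum {κ : Type*} (s : Finset κ) {Φ : κ → Observable d k → ι → ℂ}
    (h : ∀ a, IsControlled (Φ a)) : IsControlled fun A i => ∑ a ∈ s, Φ a A i := by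
  classical
  induction s using Finset.induction_on with
  | empty =>
    simp only [Finset.sum_empty]
    exact zero
  | insert a s ha ih =>
    simp only [Finset.sum_insert ha]
    exact (h a).add ih

end IsControlled

theorem continuous_of_isControlled (Ψ : Observable d k →+ Observable d m)
    (h : ∀ S S' : Set (Bosonic d m), IsVonNBounded ℂ S → IsVonNBounded ℂ S' →
      IsControlled fun (A : Observable d k) (i : S × S') => l2Inner i.2.1 ((Ψ A).op i.1.1)) :
    Continuous Ψ := by
  refine continuous_of_continuousAt_zero Ψ ?_
  rw [ContinuousAt, map_zero,
    Observable.hasBasis_nhds_zero.tendsto_iff Observable.hasBasis_nhds_zero]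
  rintro ⟨S, S', δ⟩ ⟨hS, hS', hδ⟩
  obtain ⟨C, C', M, hC, hC', hM, hb⟩ := h S S' hS hS'
  -- M + 1 in place of M avoids dividing by zero.
  refine ⟨⟨C, C', δ / (M + 1)⟩, ⟨hC, hC', by positivity⟩, fun A hA u hu v hv => ?_⟩
  refine (hb A (δ / (M + 1)) (by positivity) hA (⟨u, hu⟩, ⟨v, hv⟩)).trans ?_
  rw [mul_div_assoc', div_le_iff₀ (by positivity), mul_comm δ]
  exact mul_le_mul_of_nonneg_right (by linarith) hδ.le

theorem norm_le_norm_insert_extendRest (i : Fin k ↪ Fin N)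
    (z : ((Set.range i)ᶜ : Set (Fin N)) → EuclideanSpace ℝ (Fin d)) :
    ‖z‖ ≤ ‖insert i (extendRest i z) 0‖ := by
  rw [pi_norm_le_iff_of_nonneg (norm_nonneg _)]
  rintro ⟨n, hn⟩
  refine le_trans (le_of_eq ?_) (norm_le_pi_norm (insert i (extendRest i z) 0) n)
  rw [insert_apply_of_notMem _ _ _ hn, extendRest, dif_pos hn]

/-- Rapid decay of slices in the frozen variables absorbs any polynomial weight in z, uniformly over
a bounded set. -/
theorem isVonNBounded_weighted_slices (i : Fin k ↪ Fin N) {S : Set (Test d N)}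
    (hS : IsVonNBounded ℂ S) (r : ℕ) :
    IsVonNBounded ℂ {u : Test d k | ∃ F ∈ S, ∃ z, u = ((1 + ‖z‖ : ℝ) ^ r : ℝ) •
      sliceMap i (extendRest i z) F} := by
  rw [isVonNBounded_test_iff] at hS ⊢
  intro a b
  obtain ⟨R, hR⟩ := hS a b
  obtain ⟨R', hR'⟩ := hS (r + a) b
  refine ⟨2 ^ (r - 1) * (R + R'), ?_⟩
  rintro _ ⟨F, hF, z, rfl⟩
  rw [map_smul_eq_mul, Real.norm_of_nonneg (by positivity)]
  calc (1 + ‖z‖) ^ r * SchwartzMap.seminorm ℝ a b (sliceMap i (extendRest i z) F)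
      ≤ (2 ^ (r - 1) * (1 ^ r + ‖z‖ ^ r)) *
          SchwartzMap.seminorm ℝ a b (sliceMap i (extendRest i z) F) := by
        gcongr
        exact add_pow_le zero_le_one (norm_nonneg _) r
    _ = 2 ^ (r - 1) * (SchwartzMap.seminorm ℝ a b (sliceMap i (extendRest i z) F) +
          ‖z‖ ^ r * SchwartzMap.seminorm ℝ a b (sliceMap i (extendRest i z) F)) := by
        rw [one_pow]; ring
    _ ≤ 2 ^ (r - 1) * (R + R') := by
        gcongr
        · exact (seminorm_sliceMap_le _ _ _ _ _).trans (hR F hF)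
        · refine le_trans ?_ ((pow_mul_seminorm_sliceMap_le i (extendRest i z) F r a b).trans
            (hR' F hF))
          gcongr
          exact norm_le_norm_insert_extendRest i z

/-- By Fubini the inner product is an integral over z of k-particle ones. Placing the weight (1 +
‖z‖) ^ r on the slices of F keeps them in a fixed bounded set and leaves (1 + ‖z‖) ^ (-r), which is
integrable for the chosen r; its integral is the constant M. -/
theorem isControlled_lift (i : Fin k ↪ Fin N) {S S' : Set (Test d N)}
    (hS : IsVonNBounded ℂ S) (hS' : IsVonNBounded ℂ S') :
    IsControlled fun (A : Observable d k) (t : S × S') => ip t.2.1 (lift i A.ext t.1.1) := by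
  let E := EuclideanSpace ℝ (Fin d)
  let μ : MeasureTheory.Measure (((Set.range i)ᶜ : Set (Fin N)) → E) := MeasureTheory.volume
  have hμ : μ.IsAddHaarMeasure := inferInstanceAs (MeasureTheory.Measure.pi fun _ =>
    (MeasureTheory.volume : MeasureTheory.Measure E)).IsAddHaarMeasure
  let r := μ.integrablePower
  refine ⟨symmetrize d k '' _, symmetrize d k '' _, ∫ z, (1 + ‖z‖) ^ (-(r : ℝ)) ∂μ,
    (isVonNBounded_weighted_slices i hS r).image (symmetrize d k),
    (isVonNBounded_weighted_slices i hS' 0).image (symmetrize d k),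
    MeasureTheory.integral_nonneg fun z => by positivity, ?_⟩
  rintro A δ hδ hA ⟨⟨F, hF⟩, ⟨G, hG⟩⟩
  change ‖ip G (lift i A.ext F)‖ ≤ _
  rw [ip_eq_integral_slices i, ← MeasureTheory.integral_mul_const]
  refine MeasureTheory.norm_integral_le_of_norm_le
    ((MeasureTheory.Measure.integrable_pow_neg_integrablePower μ).mul_const δ)
    (Filter.Eventually.of_forall fun z => ?_)
  have hz : 0 < 1 + ‖z‖ := by positivity
  rw [sliceMap_lift, A.ext_apply, ← ip_symmetrize_coe, ← l2Inner_eq_ip, Real.rpow_neg hz.le,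
    Real.rpow_natCast, ← div_eq_inv_mul, le_div_iff₀ (by positivity)]
  have := hA _ ⟨_, ⟨F, hF, z, rfl⟩, rfl⟩ _ ⟨_, ⟨G, hG, z, rfl⟩, rfl⟩
  rw [pow_zero, one_smul, (symmetrize d k).map_smul_of_tower, A.op.map_smul_of_tower,
    l2Inner_real_smul_right, norm_mul, Complex.norm_real,
    Real.norm_of_nonneg (by positivity)] at this
  rwa [mul_comm]

theorem IsControlled.comp {ι κ : Type*} {Φ : Observable d k → ι → ℂ} (h : IsControlled Φ)
    (g : κ → ι) : IsControlled fun A i => Φ A (g i) := by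
  obtain ⟨C, C', M, hC, hC', hM, hb⟩ := h
  exact ⟨C, C', M, hC, hC', hM, fun A δ hδ hA i => hb A δ hδ hA (g i)⟩

theorem isVonNBounded_image_val {S : Set (Bosonic d N)} (hS : IsVonNBounded ℂ S) :
    IsVonNBounded ℂ (Subtype.val '' S : Set (Test d N)) :=
  hS.image (bosonic d N).subtypeL

/-- Controlled expectation values of a lifted observable, transformed by fixed operators. -/
theorem isControlled_lift_comp (i : Fin k ↪ Fin N) {S S' : Set (Bosonic d N)}
    (hS : IsVonNBounded ℂ S) (hS' : IsVonNBounded ℂ S') (T T' : Test d N →L[ℂ] Test d N) :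
    IsControlled fun (A : Observable d k) (t : S × S') =>
      ip (T' t.2.1.1) (lift i A.ext (T t.1.1.1)) :=
  (isControlled_lift i ((isVonNBounded_image_val hS).image T)
    ((isVonNBounded_image_val hS').image T')).comp fun t : S × S' =>
      (⟨T t.1.1.1, _, ⟨_, t.1.2, rfl⟩, rfl⟩, ⟨T' t.2.1.1, _, ⟨_, t.2.2, rfl⟩, rfl⟩)

theorem continuous_embed : Continuous (embed N : Observable d k → Observable d N) := by
  refine continuous_of_isControlled (embedL d k N).toAddMonoidHom fun S S' hS hS' => ?_
  have h := (IsControlled.sum Finset.univ fun i : Fin k ↪ Fin N =>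
    isControlled_lift_comp i hS hS' (.id ℂ _) (.id ℂ _)).const_mul (normConst k N : ℂ)
  convert h using 3 with A t
  change l2Inner t.2.1 ((embed N A).op t.1.1) = _
  rw [l2Inner_eq_ip, embed_op, ip_smul_right, sumLift_apply, ip_sum_right]
  rfl

/-- In the second half of the commutator the lift of B is moved to the left entry, so that each term
contains one lift of A between test functions transformed by fixed operators. -/
theorem ip_commOp (A : Observable d l) (B : Observable d j) (F G : Test d m) :
    ip G (commOp m N A.ext B.ext F) = ∑ a : (Fin l ↪ Fin m) × (Fin j ↪ Fin m),
      ((totalCount N a : ℝ)⁻¹ : ℝ) * (ip G (lift a.1 A.ext (lift a.2 B.ext F)) +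
        ip (lift a.2 B.ext G) (lift a.1 A.ext F)) := by
  rw [commOp_apply, ip_sum_right]
  refine Finset.sum_congr rfl fun a _ => ?_
  rw [← Complex.coe_smul, ip_smul_right, liftComm_apply, ip_sub_right,
    B.isSkew_ext.lift a.2 G, sub_eq_add_neg]

/-- The lifts of the fixed B are continuous and map bounded sets to bounded sets, so each term is
controlled by `isControlled_lift_comp`. -/
theorem isControlled_commObs (B : Observable d j) {S S' : Set (Bosonic d m)}
    (hS : IsVonNBounded ℂ S) (hS' : IsVonNBounded ℂ S') :
    IsControlled fun (A : Observable d l) (t : S × S') =>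
      l2Inner t.2.1 ((commObs m N A B).op t.1.1) := by
  have h := (IsControlled.sum Finset.univ fun a : (Fin l ↪ Fin m) × (Fin j ↪ Fin m) =>
    ((isControlled_lift_comp a.1 hS hS' (lift a.2 B.ext) (.id ℂ _)).add
      (isControlled_lift_comp a.1 hS hS' (.id ℂ _) (lift a.2 B.ext))).const_mul
        (((totalCount N a : ℝ)⁻¹ : ℝ) : ℂ)).const_mul
    ((N * normConst l N * normConst j N * Fintype.card (Fin m ↪ Fin N) *
      (normConst m N)⁻¹ : ℝ) : ℂ)
  convert h using 3 with A t
  rw [l2Inner_eq_ip, commObs_op, ← Complex.coe_smul, ip_smul_right, ip_commOp]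
  rfl

end Topology

/-! ### The Lie algebra of hierarchies -/

section LieAlgebra

variable {d k l j m N : ℕ}

namespace Observable

theorem lie_op_eq (A B : Observable d N) (f : Bosonic d N) :
    (A.lie B).op f = (N : ℝ) • (A.op (B.op f) - B.op (A.op f)) := rfl

theorem ext_op {A B : Observable d N} (h : ∀ f, A.op f = B.op f) : A = B :=
  op_injective (ContinuousLinearMap.ext h)

theorem lie_add_left (A A' B : Observable d N) : (A + A').lie B = A.lie B + A'.lie B :=
  ext_op fun f => by
    simp only [lie_op_eq, op_add, map_add, ← smul_add]
    congr 1
    abel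

theorem lie_smul_left (c : ℝ) (A B : Observable d N) : (c • A).lie B = c • A.lie B :=
  ext_op fun f => by
    simp only [lie_op_eq, op_smul, B.op.map_smul_of_tower, ← smul_sub]
    rw [smul_comm]

theorem lie_swap (A B : Observable d N) : A.lie B = -B.lie A :=
  ext_op fun f => by
    have h : (-B.lie A).op f = -(B.lie A).op f := rfl
    rw [h, lie_op_eq, lie_op_eq, ← smul_neg, neg_sub]

theorem lie_add_right (A B B' : Observable d N) : A.lie (B + B') = A.lie B + A.lie B' := by
  rw [lie_swap, lie_add_left, neg_add, ← lie_swap, ← lie_swap]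

theorem lie_sum_right {ι : Type*} (s : Finset ι) (A : Observable d N) (B : ι → Observable d N) :
    A.lie (∑ i ∈ s, B i) = ∑ i ∈ s, A.lie (B i) :=
  map_sum (AddMonoidHom.mk' A.lie (A.lie_add_right)) B s

theorem lie_zero (A : Observable d N) : A.lie 0 = 0 :=
  map_zero (AddMonoidHom.mk' A.lie (A.lie_add_right))

theorem lie_jacobi (A B C : Observable d N) :
    A.lie (B.lie C) + C.lie (A.lie B) + B.lie (C.lie A) = 0 :=
  ext_op fun f => by
    simp only [lie_op_eq, op_add, map_sub, A.op.map_smul_of_tower, B.op.map_smul_of_tower,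
      C.op.map_smul_of_tower, ← smul_sub, ← smul_add]
    have h : (0 : Observable d N).op f = 0 := rfl
    rw [h]
    convert smul_zero _
    convert smul_zero _
    abel

end Observable

theorem embed_sum {ι : Type*} (s : Finset ι) (A : ι → Observable d k) :
    embed N (∑ i ∈ s, A i) = ∑ i ∈ s, embed N (A i) := map_sum (embedL d k N) A s

/-- The commutator lies in the image of the injective embedding, so `Function.invFun` returns its
genuine preimage and no default value. -/
theorem invFun_lie (hm1 : 1 ≤ m) (hmN : m ≤ N) (hm : min (l + j - 1) N ≤ m) (A : Observable d l)
    (B : Observable d j) : Function.invFun (embed N : Observable d m → Observable d N)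
      (Observable.lie (embed N A) (embed N B)) = commObs m N A B := by
  rw [lie_embed_embed hmN hm]
  exact Function.leftInverse_invFun (embed_injective hm1 hmN) _

theorem bracket_apply (A B : Hier d N) (k : ↥(Finset.Icc 1 N)) : bracket A B k =
    ∑ p : ↥(Finset.Icc 1 N) × ↥(Finset.Icc 1 N) with min (p.1.1 + p.2.1 - 1) N = k.1,
      commObs k.1 N (A p.1) (B p.2) := by
  have hk := Finset.mem_Icc.1 k.2
  exact Finset.sum_congr rfl fun p hp => invFun_lie hk.1 hk.2 (Finset.mem_filter.1 hp).2.le _ _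

theorem embed_bracket (A B : Hier d N) (k : ↥(Finset.Icc 1 N)) : embed N (bracket A B k) =
    ∑ p : ↥(Finset.Icc 1 N) × ↥(Finset.Icc 1 N) with min (p.1.1 + p.2.1 - 1) N = k.1,
      Observable.lie (embed N (A p.1)) (embed N (B p.2)) := by
  have hk := Finset.mem_Icc.1 k.2
  rw [bracket_apply, embed_sum]
  exact Finset.sum_congr rfl fun p hp =>
    (lie_embed_embed hk.2 (Finset.mem_filter.1 hp).2.le _ _).symm

/-- By injectivity, identities between hierarchies can be checked componentwise inside 𝔤_N. -/
theorem hier_ext {A B : Hier d N} (h : ∀ k, embed N (A k) = embed N (B k)) : A = B :=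
  funext fun k => embed_injective (Finset.mem_Icc.1 k.2).1 (Finset.mem_Icc.1 k.2).2 (h k)

theorem bracket_add_left (A A' B : Hier d N) :
    bracket (A + A') B = bracket A B + bracket A' B := hier_ext fun k => by
  rw [Pi.add_apply, embed_add, embed_bracket, embed_bracket, embed_bracket,
    ← Finset.sum_add_distrib]
  exact Finset.sum_congr rfl fun p _ => by
    rw [Pi.add_apply, embed_add, Observable.lie_add_left]

theorem bracket_smul_left (c : ℝ) (A B : Hier d N) :
    bracket (c • A) B = c • bracket A B := hier_ext fun k => by
  rw [Pi.smul_apply, embed_smul, embed_bracket, embed_bracket, Finset.smul_sum]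
  exact Finset.sum_congr rfl fun p _ => by
    rw [Pi.smul_apply, embed_smul, Observable.lie_smul_left]

theorem bracket_swap (A B : Hier d N) : bracket A B = -bracket B A := hier_ext fun k => by
  have h : embed N ((-bracket B A) k) = -embed N (bracket B A k) := map_neg (embedL d k.1 N) _
  rw [h, embed_bracket, embed_bracket, ← Finset.sum_neg_distrib]
  refine Finset.sum_equiv (Equiv.prodComm _ _) (fun p => ?_) fun p _ => Observable.lie_swap _ _
  simp [add_comm]

/-- For a ≥ 1, truncating b + c - 1 at N before adding a changes nothing after the outer truncation:
min(a + min(b + c - 1, N) - 1, N) = min(a + b + c - 2, N). The condition is thus symmetric in the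
three degrees, as the Jacobi identity requires. -/
theorem embed_bracket_bracket (A B C : Hier d N) (k : ↥(Finset.Icc 1 N)) :
    embed N (bracket A (bracket B C) k) = ∑ a, ∑ b, ∑ c,
      if min (a.1 + b.1 + c.1 - 2) N = k.1 then
        Observable.lie (embed N (A a)) (Observable.lie (embed N (B b)) (embed N (C c)))
      else 0 := by
  rw [embed_bracket, Finset.sum_filter, Fintype.sum_prod_type]
  refine Finset.sum_congr rfl fun a _ => ?_
  have ha := Finset.mem_Icc.1 a.2
  simp only [embed_bracket, Observable.lie_sum_right, Finset.sum_filter]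
  simp only [apply_ite, Observable.lie_zero, Fintype.sum_prod_type]
  simp only [← Finset.sum_filter (s := (Finset.univ : Finset ↥(Finset.Icc 1 N)))
    (p := fun e => min (a.1 + e.1 - 1) N = k.1)]
  rw [Finset.sum_comm]
  refine Finset.sum_congr rfl fun b _ => ?_
  rw [Finset.sum_comm]
  refine Finset.sum_congr rfl fun c _ => ?_
  have hb := Finset.mem_Icc.1 b.2
  have hc := Finset.mem_Icc.1 c.2
  -- For given b and c exactly one component of the inner bracket receives their commutator.
  let e : ↥(Finset.Icc 1 N) := ⟨min (b.1 + c.1 - 1) N, Finset.mem_Icc.2 (by omega)⟩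
  rw [Finset.sum_filter, Finset.sum_eq_single e]
  · have : min (a.1 + e.1 - 1) N = min (a.1 + b.1 + c.1 - 2) N := by
      change min (a.1 + min (b.1 + c.1 - 1) N - 1) N = _
      omega
    rw [this, if_pos (show min (b.1 + c.1 - 1) N = e.1 from rfl)]
  · intro e' _ he'
    rw [if_neg (show ¬ min (b.1 + c.1 - 1) N = e'.1 from fun h => he' (Subtype.ext h.symm))]
    exact ite_self _
  · exact fun h => absurd (Finset.mem_univ e) h

theorem sum_cyclic_eq_zero {X M : Type*} [Fintype X] [AddCommMonoid M] {f g h : X → X → X → M}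
    (hfgh : ∀ a b c, f a b c + g c a b + h b c a = 0) :
    ∑ a, ∑ b, ∑ c, f a b c + ∑ c, ∑ a, ∑ b, g c a b + ∑ b, ∑ c, ∑ a, h b c a = 0 := by
  have hrot (F : X → X → X → M) : ∑ c, ∑ a, ∑ b, F c a b = ∑ a, ∑ b, ∑ c, F c a b := by
    rw [Finset.sum_comm]
    exact Finset.sum_congr rfl fun a _ => Finset.sum_comm
  rw [hrot g, (hrot h).trans (hrot fun c a b => h b c a)]
  simp only [← Finset.sum_add_distrib, hfgh, Finset.sum_const_zero]

theorem bracket_jacobi (A B C : Hier d N) :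
    bracket A (bracket B C) + bracket C (bracket A B) + bracket B (bracket C A) = 0 :=
  hier_ext fun k => by
    have h0 : embed N ((0 : Hier d N) k) = 0 := map_zero (embedL d k.1 N)
    rw [Pi.add_apply, Pi.add_apply, embed_add, embed_add, h0, embed_bracket_bracket,
      embed_bracket_bracket, embed_bracket_bracket]
    refine sum_cyclic_eq_zero fun a b c => ?_
    have e1 : c.1 + a.1 + b.1 = a.1 + b.1 + c.1 := by ring
    have e2 : b.1 + c.1 + a.1 = a.1 + b.1 + c.1 := by ring
    simp only [e1, e2]
    by_cases h : min (a.1 + b.1 + c.1 - 2) N = k.1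
    · simp only [if_pos h]
      exact Observable.lie_jacobi _ _ _
    · simp only [if_neg h, add_zero]

theorem continuous_commObs_left (hm1 : 1 ≤ m) (hmN : m ≤ N) (hm : min (l + j - 1) N ≤ m)
    (B : Observable d j) : Continuous fun A : Observable d l => commObs m N A B := by
  -- Additivity of `commObs` in A is inherited from the bracket of 𝔤_N through the injective
  -- embedding.
  let Ψ : Observable d l →+ Observable d m := AddMonoidHom.mk' (fun A => commObs m N A B)
    fun A A' => embed_injective hm1 hmN (by
      rw [embed_add, ← lie_embed_embed hmN hm, ← lie_embed_embed hmN hm,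
        ← lie_embed_embed hmN hm, embed_add, Observable.lie_add_left])
  exact continuous_of_isControlled Ψ fun S S' hS hS' => isControlled_commObs B hS hS'

theorem continuous_bracket_left (B : Hier d N) : Continuous fun A : Hier d N => bracket A B := by
  refine continuous_pi fun k => ?_
  have hk := Finset.mem_Icc.1 k.2
  simp only [bracket_apply]
  exact continuous_finsetSum _ fun p hp => (continuous_commObs_left hk.1 hk.2
    (Finset.mem_filter.1 hp).2.le (B p.2)).comp (continuous_apply p.1)

theorem isLieAlgebra_hier (d N : ℕ) : IsLieAlgebra (Hier d N) bracket where
  isTopologicalAddGroup := inferInstance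
  continuousSMul := inferInstance
  locallyConvex := inferInstance
  hausdorff := inferInstance
  continuous_left := continuous_bracket_left
  continuous_right A := by
    simp only [bracket_swap A]
    exact (continuous_bracket_left A).neg
  add_left := bracket_add_left
  add_right A B B' := by
    rw [bracket_swap, bracket_add_left, neg_add, ← bracket_swap, ← bracket_swap]
  smul_left := bracket_smul_left
  smul_right c A B := by
    rw [bracket_swap, bracket_smul_left, ← smul_neg, ← bracket_swap]
  self A := by
    have h := bracket_swap A A
    rwa [eq_neg_iff_add_eq_zero, ← two_smul ℝ, smul_eq_zero_iff_right two_ne_zero] at h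
  jacobi := bracket_jacobi

end LieAlgebra

end Hierarchy

end

theorem proposition2p1 (d N : ℕ) (hd : 1 ≤ d) (hN : 1 ≤ N) :
    (∀ k : ℕ, 1 ≤ k → k ≤ N →
      (∀ A : Hierarchy.Observable d k, Hierarchy.IsEmbedded A (Hierarchy.embed N A)) ∧
      IsLinearMap ℝ
        (Hierarchy.embed N : Hierarchy.Observable d k → Hierarchy.Observable d N) ∧
      Continuous
        (Hierarchy.embed N : Hierarchy.Observable d k → Hierarchy.Observable d N) ∧
      Function.Injective
        (Hierarchy.embed N : Hierarchy.Observable d k → Hierarchy.Observable d N)) ∧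
    (∀ l j : ℕ, 1 ≤ l → l ≤ N → 1 ≤ j → j ≤ N →
      ∀ (A : Hierarchy.Observable d l) (B : Hierarchy.Observable d j),
        ∃ C : Hierarchy.Observable d (min (l + j - 1) N),
          Hierarchy.Observable.lie (Hierarchy.embed N A) (Hierarchy.embed N B) =
            Hierarchy.embed N C) ∧
    Hierarchy.IsLieAlgebra (Hierarchy.Hier d N) Hierarchy.bracket :=
  ⟨fun _ hk hkN => ⟨Hierarchy.isEmbedded_embed,
    ⟨Hierarchy.embed_add, Hierarchy.embed_smul⟩, Hierarchy.continuous_embed,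
    Hierarchy.embed_injective hk hkN⟩,
    fun _ _ _ _ _ _ A B => ⟨Hierarchy.commObs _ N A B,
      Hierarchy.lie_embed_embed (min_le_right _ _) le_rfl A B⟩,
    Hierarchy.isLieAlgebra_hier d N⟩
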